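/- Let $V\neq 0$ be a finite-dimensional simple Euclidean Jordan algebra over $\mathbb{R}$ with identity $e$: a real inner product space with a commutative bilinear product $ab=L(a)b$ satisfying $a^2(ab)=a(a^2b)$ and $\langle xu,v\rangle=\langle u,xv\rangle$, having no ideals other than $0$ and $V$. Let $\Omega$ be the interior of $\{x^2: x\in V\}$, let $G(\Omega)$ be the group of invertible linear maps $g$ of $V$ with $g\Omega=\Omega$, let $H=G(\Omega)_o$ be its identity component, and let $\mathfrak h$ be the Lie algebra of $H$. Let $V_{\mathbb C}=V\otimes_{\mathbb R}\mathbb C$, let $P(\zeta)=2L(\zeta)^2-L(\zeta^2)$ be the quadratic representation of $V_{\mathbb C}$, and for $z,w\in V_{\mathbb C}$ and a complex linear operator $T$ on $V_{\mathbb C}$ let $X(z,T,w)$ be the vector field $\zeta\mapsto z+T\zeta-P(\zeta)w$ on $V_{\mathbb C}$. The Lie algebra $\mathfrak g$ of the identity component of the group of holomorphic automorphisms of the tube domain $T(\Omega)=\Omega+iV$ is described as the space of vector fields $X(iu,T,iv)$ with $u,v\in V$, $T\in\mathfrak h$. Its complexification $\mathfrak g_{\mathbb C}$ is the space of vector fields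 $X(z,T,w)$ with $z,w\in V_{\mathbb C}$, $T\in\mathfrak h_{\mathbb C}$, with the bracket $[X,Y]=DX\cdot Y-DY\cdot X$. A linear map $k\in G(\Omega)$ acts on it by $\mathrm{Ad}(k)X=k\circ X\circ k^{-1}$, and for a subgroup $S$ of $G(\Omega)$ we write $\mathfrak g_{\mathbb C}^{S}$ for the space of vectors of $\mathfrak g_{\mathbb C}$ fixed by $\mathrm{Ad}(k)$ for all $k\in S$. Put $$\textsc{x}=\tfrac12X(e,2L(e),-e),\qquad \textsc{y}=\tfrac12X(-e,2L(e),e),\qquad \textsc{z}=X(-e,0,-e),$$ and let $\mathfrak s$ be the complex span of $\textsc{x},\textsc{y},\textsc{z}$. Then: 1. If $\dim V\neq 3$ and $L=\{k\in H: ke=e\}$, then $\mathfrak g_{\mathbb C}^{L}=\mathfrak s$. 2. For every $V$ as above, including $\dim V=3$, $\mathfrak g_{\mathbb C}^{\widetilde L}=\mathfrak s$, where $\widetilde L=\{k\in G(\Omega): ke=e\}$ is the stabilizer of $e$ in the whole group $G(\Omega)$. 3. $\mathfrak s$ is closed under the bracket and is isomorphic, as a complex Lie algebra, to $\mathfrak{sl}(2,\mathbb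 C)$. -/

import Mathlib

open scoped TensorProduct

noncomputable section

/-- A Euclidean Jordan algebra with identity `e` on a real inner product space `V`: a commutative
bilinear product `a b = L a b` with `a² (a b) = a (a² b)`, whose inner product is associative,
`⟪x u, v⟫ = ⟪u, x v⟫`. Here `L a` is left multiplication by `a`. -/
structure EuclideanJordanAlgebra (V : Type*) [NormedAddCommGroup V] [InnerProductSpace ℝ V] where
  L : V →ₗ[ℝ] V →ₗ[ℝ] V
  e : V
  L_comm : ∀ a b, L a b = L b a
  L_jordan : ∀ a b, L (L a a) (L a b) = L a (L (L a a) b)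
  L_e : ∀ a, L e a = a
  inner_L : ∀ x u v, inner ℝ (L x u) v = inner ℝ u (L x v)

namespace EuclideanJordanAlgebra

variable {V : Type*} [NormedAddCommGroup V] [InnerProductSpace ℝ V]
variable (J : EuclideanJordanAlgebra V)

/-- `V` is nonzero and its only ideals are `0` and `V`. -/
def IsSimple : Prop :=
  Nontrivial V ∧
    ∀ I : Submodule ℝ V, (∀ a : V, ∀ x ∈ I, J.L a x ∈ I) → I = ⊥ ∨ I = ⊤

/-! ### The symmetric cone and its linear automorphisms -/

/-- The symmetric cone `Ω`: the interior of the set of squares. -/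
def cone : Set V := interior {y | ∃ x, y = J.L x x}

/-- `G(Ω)`: the invertible linear transformations of `V` that leave `Ω` invariant. -/
def coneGroup : Subgroup (V →L[ℝ] V)ˣ where
  carrier := {g | (g : V →L[ℝ] V) '' J.cone = J.cone}
  one_mem' := by simp
  mul_mem' := by
    intro a b ha hb
    have h : ((a * b : (V →L[ℝ] V)ˣ) : V →L[ℝ] V) '' J.cone
        = (a : V →L[ℝ] V) '' ((b : V →L[ℝ] V) '' J.cone) := by
      rw [Set.image_image]; rfl
    simp only [Set.mem_ofPred_eq] at ha hb ⊢
    rw [h, hb, ha]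
  inv_mem' := by
    intro a ha
    simp only [Set.mem_ofPred_eq] at ha ⊢
    conv_lhs => rw [← ha]
    rw [Set.image_image]
    have h : ∀ x, ((a⁻¹ : (V →L[ℝ] V)ˣ) : V →L[ℝ] V) ((a : V →L[ℝ] V) x) = x := fun x => by
      rw [← mul_apply_eq_comp, a.inv_mul, one_apply_eq_self]
    simp [h]

/-- `H = G(Ω)ₒ`: the connected component of the identity of `G(Ω)`. -/
def H : Subgroup (V →L[ℝ] V)ˣ :=
  (Subgroup.connectedComponentOfOne J.coneGroup).map J.coneGroup.subtype

/-- The invertible linear transformations of `V` that fix `e`. -/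
def stabilizerOfOne : Subgroup (V →L[ℝ] V)ˣ where
  carrier := {g | (g : V →L[ℝ] V) J.e = J.e}
  one_mem' := by simp
  mul_mem' := by
    intro a b ha hb
    simp only [Set.mem_ofPred_eq] at ha hb ⊢
    rw [Units.val_mul, mul_apply_eq_comp, hb, ha]
  inv_mem' := by
    intro a ha
    simp only [Set.mem_ofPred_eq] at ha ⊢
    conv_lhs => rw [← ha]
    rw [← mul_apply_eq_comp, a.inv_mul, one_apply_eq_self]

/-- `L = K ∩ H`: the elements of `H` that fix `e`. -/
def isotropy : Subgroup (V →L[ℝ] V)ˣ := J.H ⊓ J.stabilizerOfOne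

/-- The elements of the whole group `G(Ω)` that fix `e`. -/
def fullIsotropy : Subgroup (V →L[ℝ] V)ˣ := J.coneGroup ⊓ J.stabilizerOfOne

/-- `𝔥`, the Lie algebra of `H`: the operators `T` such that `exp (t T) ∈ H` for all real `t`. -/
def lieH : Set (V →L[ℝ] V) :=
  {T | ∀ t : ℝ, ∃ g ∈ J.H, (g : V →L[ℝ] V) = NormedSpace.exp (t • T)}

/-! ### The complexification -/

/-- The complexified product of `V_ℂ = ℂ ⊗ V`. -/
def LC : ℂ ⊗[ℝ] V →ₗ[ℂ] ℂ ⊗[ℝ] V →ₗ[ℂ] ℂ ⊗[ℝ] V :=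
  LinearMap.BilinMap.baseChange ℂ J.L

/-- The identity element of `V_ℂ`. -/
def eC : ℂ ⊗[ℝ] V := (1 : ℂ) ⊗ₜ[ℝ] J.e

/-- The quadratic representation `P(z) = 2 L(z)² - L(z²)` of `V_ℂ`. -/
def P (z : ℂ ⊗[ℝ] V) : ℂ ⊗[ℝ] V →ₗ[ℂ] ℂ ⊗[ℝ] V :=
  (2 : ℂ) • (J.LC z ∘ₗ J.LC z) - J.LC (J.LC z z)

/-- The complex linear extension to `V_ℂ` of an operator on `V`. -/
def extC (T : V →L[ℝ] V) : Module.End ℂ (ℂ ⊗[ℝ] V) :=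
  (T : V →ₗ[ℝ] V).baseChange ℂ

/-- `𝔥_ℂ`, as a complex space of operators on `V_ℂ`. -/
def lieHC : Submodule ℂ (Module.End ℂ (ℂ ⊗[ℝ] V)) :=
  Submodule.span ℂ (extC '' J.lieH)

/-! ### Vector fields -/

/-- The vector field `X(z, T, w)` on `V_ℂ`, with value `z + T ζ - P(ζ) w` at `ζ`; it depends
linearly on the triple `(z, T, w)`. -/
def X : (ℂ ⊗[ℝ] V) × Module.End ℂ (ℂ ⊗[ℝ] V) × (ℂ ⊗[ℝ] V) →ₗ[ℂ]
    (ℂ ⊗[ℝ] V → ℂ ⊗[ℝ] V) where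
  toFun p := fun ζ => p.1 + p.2.1 ζ - J.P ζ p.2.2
  map_add' p q := by
    funext ζ
    simp only [Prod.fst_add, Prod.snd_add, LinearMap.add_apply, map_add, Pi.add_apply]
    abel
  map_smul' c p := by
    funext ζ
    simp [smul_add, smul_sub]

/-- The Lie bracket of vector fields, `[X, Y] = DX · Y - DY · X`. (Mathlib's `lieBracket` has the
opposite sign. For holomorphic vector fields the real derivative is the complex one.) -/
def bracket (X Y : ℂ ⊗[ℝ] V → ℂ ⊗[ℝ] V) : ℂ ⊗[ℝ] V → ℂ ⊗[ℝ] V :=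
  VectorField.lieBracket ℝ Y X

/-- The real Lie algebra `𝔤 = 𝔫⁺ ⊕ 𝔥 ⊕ 𝔫⁻` of the vector fields
`X(iu, T, iv)`, with `u, v ∈ V` and `T ∈ 𝔥`, that is, of the automorphism group of the tube
domain `Ω + iV`. -/
def lieG : Set (ℂ ⊗[ℝ] V → ℂ ⊗[ℝ] V) :=
  {Y | ∃ u v : V, ∃ T ∈ J.lieH,
    Y = J.X (Complex.I ⊗ₜ[ℝ] u, extC T, Complex.I ⊗ₜ[ℝ] v)}

/-- The complexification `𝔤_ℂ`: the vector fields `X(z, T, w)` with `z, w ∈ V_ℂ` and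
`T ∈ 𝔥_ℂ`. By `span_lieG` it is the complex span of `𝔤`. -/
def lieGC : Submodule ℂ (ℂ ⊗[ℝ] V → ℂ ⊗[ℝ] V) :=
  ((⊤ : Submodule ℂ (ℂ ⊗[ℝ] V)).prod (J.lieHC.prod ⊤)).map J.X

theorem span_lieG : Submodule.span ℂ J.lieG = J.lieGC := by
  have hz : (0 : V →L[ℝ] V) ∈ J.lieH := fun t => ⟨1, J.H.one_mem, by simp⟩
  have h0 : extC (0 : V →L[ℝ] V) = 0 := by simp [extC]
  apply le_antisymm
  · rw [Submodule.span_le]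
    rintro _ ⟨u, v, T, hT, rfl⟩
    exact ⟨_, ⟨trivial, Submodule.subset_span ⟨T, hT, rfl⟩, trivial⟩, rfl⟩
  · rintro _ ⟨⟨z, T, w⟩, ⟨-, hT, -⟩, rfl⟩
    have key : ∀ (M : Submodule ℂ (ℂ ⊗[ℝ] V)),
        (∀ u : V, Complex.I ⊗ₜ[ℝ] u ∈ M) → ∀ z, z ∈ M := by
      intro M hM z
      induction z using TensorProduct.induction_on with
      | zero => exact M.zero_mem
      | add a b ha hb => exact M.add_mem ha hb
      | tmul c u =>
        have := M.smul_mem (-(c * Complex.I)) (hM u)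
        rw [TensorProduct.smul_tmul'] at this
        convert this using 2
        rw [smul_eq_mul, neg_mul, mul_assoc, Complex.I_mul_I]
        ring
    have h1 : J.X (z, 0, 0) ∈ Submodule.span ℂ J.lieG :=
      key ((Submodule.span ℂ J.lieG).comap (J.X ∘ₗ LinearMap.inl ℂ _ _))
        (fun u => Submodule.subset_span ⟨u, 0, 0, hz, by rw [h0]; simp; rfl⟩) z
    have h3 : J.X (0, 0, w) ∈ Submodule.span ℂ J.lieG :=
      key ((Submodule.span ℂ J.lieG).comap
          (J.X ∘ₗ LinearMap.inr ℂ _ _ ∘ₗ LinearMap.inr ℂ _ _))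
        (fun u => Submodule.subset_span ⟨0, u, 0, hz, by rw [h0]; simp⟩) w
    have h2 : J.X (0, T, 0) ∈ Submodule.span ℂ J.lieG := by
      have hle : J.lieHC ≤ (Submodule.span ℂ J.lieG).comap
          (J.X ∘ₗ LinearMap.inr ℂ _ _ ∘ₗ LinearMap.inl ℂ _ _) := by
        rw [lieHC, Submodule.span_le]
        rintro _ ⟨S, hS, rfl⟩
        exact Submodule.subset_span ⟨0, 0, S, hS, by simp⟩
      exact hle hT
    have : J.X (z, T, w) = J.X (z, 0, 0) + J.X (0, T, 0) + J.X (0, 0, w) := by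
      rw [← map_add, ← map_add]; simp
    rw [this]
    exact add_mem (add_mem h1 h2) h3

/-! ### Fixed vectors -/

/-- The adjoint action of a linear transformation `k` on vector fields: `Ad(k) Y = k ∘ Y ∘ k⁻¹`. -/
def Ad (k : (V →L[ℝ] V)ˣ) (Y : ℂ ⊗[ℝ] V → ℂ ⊗[ℝ] V) : ℂ ⊗[ℝ] V → ℂ ⊗[ℝ] V :=
  fun ζ => extC (k : V →L[ℝ] V) (Y (extC ((k⁻¹ : (V →L[ℝ] V)ˣ) : V →L[ℝ] V) ζ))

/-- The vectors of `𝔤_ℂ` that are fixed by every element of the group `S`. -/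
def fixedVectors (S : Subgroup (V →L[ℝ] V)ˣ) : Submodule ℂ (ℂ ⊗[ℝ] V → ℂ ⊗[ℝ] V) where
  carrier := {Y | Y ∈ J.lieGC ∧ ∀ k ∈ S, Ad k Y = Y}
  zero_mem' := ⟨zero_mem _, fun k _ => by funext ζ; simp [Ad]⟩
  add_mem' := by
    rintro Y Z ⟨hY, hY'⟩ ⟨hZ, hZ'⟩
    refine ⟨add_mem hY hZ, fun k hk => ?_⟩
    conv_rhs => rw [← hY' k hk, ← hZ' k hk]
    funext ζ
    simp [Ad]
  smul_mem' := by
    rintro c Y ⟨hY, hY'⟩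
    refine ⟨Submodule.smul_mem _ c hY, fun k hk => ?_⟩
    conv_rhs => rw [← hY' k hk]
    funext ζ
    simp [Ad]

/-- `x = ½ X(e, 2 L(e), -e)`. -/
def xField : ℂ ⊗[ℝ] V → ℂ ⊗[ℝ] V :=
  (1 / 2 : ℂ) • J.X (J.eC, (2 : ℂ) • J.LC J.eC, -J.eC)

/-- `y = ½ X(-e, 2 L(e), e)`. -/
def yField : ℂ ⊗[ℝ] V → ℂ ⊗[ℝ] V :=
  (1 / 2 : ℂ) • J.X (-J.eC, (2 : ℂ) • J.LC J.eC, J.eC)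

/-- `z = X(-e, 0, -e)`. -/
def zField : ℂ ⊗[ℝ] V → ℂ ⊗[ℝ] V :=
  J.X (-J.eC, 0, -J.eC)

/-- `𝔰`, the complex span of `x`, `y`, `z`. -/
def spanXYZ : Submodule ℂ (ℂ ⊗[ℝ] V → ℂ ⊗[ℝ] V) :=
  Submodule.span ℂ {J.xField, J.yField, J.zField}

end EuclideanJordanAlgebra

end

namespace EuclideanJordanAlgebra

variable {V : Type*} [NormedAddCommGroup V] [InnerProductSpace ℝ V]
variable (J : EuclideanJordanAlgebra V)

/-! ### Linearizations of the Jordan identity -/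

/-! A field `X(z, T, w)` determines its triple, and an automorphism `k` acts on it by `z ↦ kz`, `T ↦
kTk⁻¹`, `w ↦ kw`. Since `𝔰` consists of the fields `X(αe, β·1, γe)`, the task is to find the fixed
vectors of `V` and the fixed operators of `𝔥`.

The spectral decomposition `exists_spectral` makes the squares a self-dual cone. Two facts follow:
an element of `G(Ω)` that fixes `e` is an automorphism, because it permutes the idempotents, and
each `T` in `𝔥` is `L(Te)` plus a derivation (`isDer_sub_of_mem_lieH`).

The inner derivations `[L(a), L(b)]` exponentiate into the isotropy group, so they kill every fixed
vector; in a simple algebra this leaves only multiples of `e`. Hence `z`, `w` and `Te` are multiples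
of `e`, and `T` is a scalar plus a derivation `D` that commutes with all inner derivations (real and
imaginary parts being treated separately). By `IsSimple.irreducible` the complement of `e` is
irreducible under inner derivations, so the symmetric operator `D²` is scalar there. If `D ≠ 0`,
this forces `V` to be a spin factor. When `dim V ≠ 3`, some inner derivation then fails to commute
with `D`. When `dim V = 3`, `D` can be a rotation of the plane `e^⊥`; a reflection, which lies in
the full stabilizer, excludes it.

Finally `X(αe, β·1, γe)` is `α + βζ - γζ²`, and such fields bracket like infinitesimal fractional
linear maps of a line, which gives `sl(2)`. -/

theorem jordan_linearized (a c b : V) :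
    J.L (J.L a a) (J.L c b) + (2 : ℝ) • J.L (J.L a c) (J.L a b) =
      J.L c (J.L (J.L a a) b) + (2 : ℝ) • J.L a (J.L (J.L a c) b) := by
  -- Half the difference of the identities at `a + c` and `a - c` is the part odd in `c`; removing
  -- the cubic term, the identity at `c`, leaves the linear part.
  have h1 := J.L_jordan (a + c) b
  have h2 := J.L_jordan (a - c) b
  have h3 := J.L_jordan c b
  simp only [map_add, map_sub, LinearMap.add_apply, LinearMap.sub_apply, J.L_comm c a] at h1 h2
  linear_combination (norm := module) (1 / 2 : ℝ) • h1 - (1 / 2 : ℝ) • h2 - h3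

theorem jordan_linearized₂ (a d c b : V) :
    J.L (J.L a d) (J.L c b) + J.L (J.L a c) (J.L d b) + J.L (J.L d c) (J.L a b) =
      J.L c (J.L (J.L a d) b) + J.L a (J.L (J.L d c) b) + J.L d (J.L (J.L a c) b) := by
  have h1 := J.jordan_linearized (a + d) c b
  have h2 := J.jordan_linearized a c b
  have h3 := J.jordan_linearized d c b
  simp only [map_add, LinearMap.add_apply, J.L_comm d a] at h1
  linear_combination (norm := module) (1 / 2 : ℝ) • h1 - (1 / 2 : ℝ) • h2 - (1 / 2 : ℝ) • h3

/-- The left side of `jordan_linearized₂` does not change when `a` and `b` are exchanged, so the two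
right sides agree; one of their terms is `b((dc)a)`, which is `L(a(cd))` applied to `b`. -/
theorem L_mul_mul (a c d : V) :
    J.L (J.L a (J.L c d)) = J.L c * J.L (J.L a d) + J.L a * J.L (J.L c d)
      + J.L d * J.L (J.L a c) - J.L c * J.L a * J.L d - J.L d * J.L a * J.L c := by
  ext b
  have h1 := J.jordan_linearized₂ a d c b
  have h2 := J.jordan_linearized₂ b d c a
  simp only [LinearMap.add_apply, LinearMap.sub_apply, Module.End.mul_apply]
  rw [J.L_comm b d, J.L_comm b c, J.L_comm b a, J.L_comm d a, J.L_comm c a,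
    J.L_comm (J.L d b) (J.L a c), J.L_comm (J.L d c) (J.L a b), J.L_comm (J.L d b) a,
    J.L_comm (J.L c b) a, J.L_comm b (J.L (J.L d c) a), J.L_comm (J.L d c) a] at h2
  rw [J.L_comm c d]
  rw [J.L_comm (J.L c b) (J.L a d)] at h2
  rw [J.L_comm (J.L d c) (J.L a b)] at h1
  linear_combination (norm := module) h1 - h2

theorem commute_L_sq (a : V) : Commute (J.L a) (J.L (J.L a a)) := by
  ext b
  exact (J.L_jordan a b).symm

/-- The powers of `x`, formed with `L x`, operator-commute with `x` and with `x²`. -/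
theorem commute_L_pow (x : V) (n : ℕ) :
    Commute (J.L x) (J.L ((J.L x ^ n) J.e)) ∧
      Commute (J.L (J.L x x)) (J.L ((J.L x ^ n) J.e)) := by
  have he : J.L J.e = 1 := LinearMap.ext J.L_e
  have hx : J.L x J.e = x := by rw [J.L_comm, J.L_e]
  have hc := J.commute_L_sq x
  induction n using Nat.twoStepInduction with
  | zero => simp [he]
  | one => simpa [hx] using hc.symm
  | more n h0 h1 =>
    have h2 : (J.L x ^ (n + 2)) J.e = J.L x (J.L x ((J.L x ^ n) J.e)) := by
      rw [pow_succ', pow_succ']; rfl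
    have h3 : (J.L x ^ (n + 1)) J.e = J.L x ((J.L x ^ n) J.e) := by
      rw [pow_succ']; rfl
    rw [h3] at h1
    -- `L(xⁿ⁺²)` becomes a polynomial in `L(x)`, `L(x²)`, `L(xⁿ)` and `L(xⁿ⁺¹)`, hence the two-step
    -- induction.
    rw [h2, L_mul_mul]
    obtain ⟨a0, b0⟩ := h0
    obtain ⟨a1, b1⟩ := h1
    have aux : ∀ T : Module.End ℝ V, Commute T (J.L x) → Commute T (J.L (J.L x x)) →
        Commute T (J.L ((J.L x ^ n) J.e)) → Commute T (J.L (J.L x ((J.L x ^ n) J.e))) →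
        Commute T (J.L x * J.L (J.L x ((J.L x ^ n) J.e)) + J.L x * J.L (J.L x ((J.L x ^ n) J.e))
          + J.L ((J.L x ^ n) J.e) * J.L (J.L x x) - J.L x * J.L x * J.L ((J.L x ^ n) J.e)
          - J.L ((J.L x ^ n) J.e) * J.L x * J.L x) := fun T t1 t2 t3 t4 =>
      (((((t1.mul_right t4).add_right (t1.mul_right t4)).add_right
        (t3.mul_right t2)).sub_right ((t1.mul_right t1).mul_right t3))).sub_right
        ((t3.mul_right t1).mul_right t1)
    exact ⟨aux _ (Commute.refl _) hc a0 a1, aux _ hc.symm (Commute.refl _) b0 b1⟩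

/-! ### Spectral decomposition -/

theorem L_e_right (a : V) : J.L a J.e = a := by rw [J.L_comm, J.L_e]

theorem isSymmetric_L (x : V) : (J.L x).IsSymmetric := fun u v => J.inner_L x u v

/-- Complete systems of orthogonal idempotents. -/
structure IsFrame {ι : Type*} (s : Finset ι) (f : ι → V) : Prop where
  orthogonal : ∀ i ∈ s, ∀ j ∈ s, i ≠ j → J.L (f i) (f j) = 0
  idempotent : ∀ i ∈ s, J.L (f i) (f i) = f i
  sum_eq : ∑ i ∈ s, f i = J.e

variable {J} in
theorem IsFrame.mul {ι : Type*} {s : Finset ι} {f : ι → V} (h : J.IsFrame s f) (a b : ι → ℝ) :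
    J.L (∑ i ∈ s, a i • f i) (∑ i ∈ s, b i • f i) = ∑ i ∈ s, (a i * b i) • f i := by
  simp only [map_sum, LinearMap.sum_apply, map_smul, LinearMap.smul_apply, Finset.smul_sum]
  rw [Finset.sum_comm]
  refine Finset.sum_congr rfl fun i hi => ?_
  rw [Finset.sum_eq_single i]
  · rw [h.idempotent i hi, smul_smul, mul_comm]
  · intro j hj hji
    rw [h.orthogonal i hi j hj hji.symm, smul_zero, smul_zero]
  · exact fun h => absurd hi h

variable {J} in
theorem IsFrame.mul_apply {ι : Type*} {s : Finset ι} {f : ι → V} (h : J.IsFrame s f) (a : ι → ℝ)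
    {j : ι} (hj : j ∈ s) : J.L (∑ i ∈ s, a i • f i) (f j) = a j • f j := by
  simp only [map_sum, LinearMap.sum_apply, map_smul, LinearMap.smul_apply]
  rw [Finset.sum_eq_single j]
  · rw [h.idempotent j hj]
  · intro i hi hij
    rw [h.orthogonal i hi j hj hij, smul_zero]
  · exact fun h => absurd hj h

/-- On the span `K` of the powers of `x` the symmetric operator `L(x)` is diagonalizable, and the
idempotents are the components of `e` in its eigenspaces. Multiplication by an element of `K`
commutes with `L(x)`, so components for distinct eigenvalues have product `0`; multiplying `e = ∑ f
l` by `f l` then gives idempotence. -/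
theorem exists_spectral [FiniteDimensional ℝ V] (x : V) :
    ∃ (s : Finset ℝ) (f : ℝ → V), J.IsFrame s f ∧ (∀ l ∈ s, f l ≠ 0) ∧
      x = ∑ l ∈ s, l • f l := by
  let K : Submodule ℝ V := Submodule.span ℝ (Set.range fun n : ℕ => (J.L x ^ n) J.e)
  have hK : ∀ v ∈ K, J.L x v ∈ K := by
    have : K ≤ K.comap (J.L x) := by
      rw [Submodule.span_le]
      rintro _ ⟨n, rfl⟩
      refine Submodule.subset_span ⟨n + 1, ?_⟩
      simp [pow_succ']
    exact this
  have hKc : ∀ v ∈ K, J.L v ∘ₗ J.L x = J.L x ∘ₗ J.L v := by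
    intro v hv
    induction hv using Submodule.span_induction with
    | mem v hv => obtain ⟨n, rfl⟩ := hv; exact (J.commute_L_pow x n).1.symm
    | zero => ext; simp
    | add a b _ _ ha hb => rw [map_add, LinearMap.add_comp, LinearMap.comp_add, ha, hb]
    | smul c a _ ha => rw [map_smul, LinearMap.smul_comp, LinearMap.comp_smul, ha]
  have hs := (J.isSymmetric_L x).restrict_invariant hK
  have htop := hs.orthogonalComplement_iSup_eigenspaces_eq_bot
  rw [Submodule.orthogonal_eq_bot_iff] at htop
  have he : J.e ∈ K := Submodule.subset_span ⟨0, by simp⟩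
  have hmem : (⟨J.e, he⟩ : K) ∈ ⨆ μ, Module.End.eigenspace ((J.L x).restrict hK) μ :=
    htop ▸ Submodule.mem_top
  obtain ⟨f, hf, hfs⟩ := (Submodule.mem_iSup_iff_exists_finsupp _ _).1 hmem
  have hL : ∀ l, J.L x (f l) = l • (f l : V) := fun l => by
    have := Module.End.mem_eigenspace_iff.1 (hf l)
    simpa using congrArg Subtype.val this
  have hsum : ∑ l ∈ f.support, (f l : V) = J.e := by
    have := congrArg Subtype.val hfs
    simpa [Finsupp.sum] using this
  have hcomm : ∀ l v, J.L x (J.L (f l) v) = J.L (f l) (J.L x v) := fun l v =>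
    (LinearMap.congr_fun (hKc (f l) (f l).2) v).symm
  have horth : ∀ l m, l ≠ m → J.L (f l : V) (f m) = 0 := by
    intro l m hlm
    have h1 : J.L x (J.L (f l) (f m)) = m • J.L (f l) (f m) := by
      rw [hcomm, hL, map_smul]
    have h2 : J.L x (J.L (f l) (f m)) = l • J.L (f l) (f m) := by
      rw [J.L_comm (f l : V), hcomm, hL, map_smul]
    rw [h1, ← sub_eq_zero, ← sub_smul, smul_eq_zero] at h2
    exact h2.resolve_left (sub_ne_zero.2 hlm.symm)
  refine ⟨f.support, fun l => f l, ⟨fun l _ m _ => horth l m, fun l hl => ?_, hsum⟩, ?_, ?_⟩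
  · have : J.L (f l : V) J.e = f l := J.L_e_right _
    rw [← hsum, map_sum, Finset.sum_eq_single l] at this
    · exact this
    · exact fun m _ hm => horth l m hm.symm
    · exact fun h => absurd hl h
  · intro l hl h
    exact Finsupp.mem_support_iff.1 hl (Subtype.ext h)
  · conv_lhs => rw [← J.L_e_right x, ← hsum, map_sum]
    exact Finset.sum_congr rfl fun l _ => hL l

/-! ### Squares -/

/-- `L(c)` is symmetric and is annihilated by `t(t - 1)(2t - 1)`, so it is positive semidefinite.
Instead of diagonalizing, the cubic relation is paired with `y` and `cy` and combined with `‖cy‖² ≥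
0` and `‖cy - c(cy)‖² ≥ 0`. -/
theorem inner_idempotent_nonneg {c : V} (hc : J.L c c = c) (y : V) :
    0 ≤ inner ℝ (J.L c y) y := by
  have h := J.jordan_linearized c y c
  rw [hc, hc, J.L_comm y c, J.L_comm (J.L c y) c] at h
  have h1 := congrArg (fun v => inner ℝ v y) h
  have h2 := congrArg (fun v => inner ℝ v (J.L c y)) h
  have h3 := real_inner_self_nonneg (x := J.L c y)
  have h4 := real_inner_self_nonneg (x := J.L c y - J.L c (J.L c y))
  simp only [inner_add_left, real_inner_smul_left, inner_sub_left, inner_sub_right, J.inner_L]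
    at h1 h2 h3 h4 ⊢
  linarith

variable {J} in
theorem IsFrame.sum_inner_nonneg {ι : Type*} {s : Finset ι} {f : ι → V} (h : J.IsFrame s f)
    {a : ι → ℝ} (ha : ∀ i ∈ s, 0 ≤ a i) (x : V) :
    0 ≤ inner ℝ (∑ i ∈ s, a i • f i) (J.L x x) := by
  rw [sum_inner]
  refine Finset.sum_nonneg fun i hi => ?_
  rw [real_inner_smul_left, ← J.inner_L, J.L_comm]
  exact mul_nonneg (ha i hi) (J.inner_idempotent_nonneg (h.idempotent i hi) x)

variable {J} in
theorem IsFrame.inner_sum {ι : Type*} {s : Finset ι} {f : ι → V} (h : J.IsFrame s f)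
    (a : ι → ℝ) {j : ι} (hj : j ∈ s) :
    inner ℝ (∑ i ∈ s, a i • f i) (f j) = a j * inner ℝ (f j) (f j) := by
  conv_lhs => rw [← h.idempotent j hj, ← J.inner_L, J.L_comm, h.mul_apply a hj]
  rw [real_inner_smul_left]

variable {J} in
theorem IsFrame.sum_isSquare {ι : Type*} {s : Finset ι} {f : ι → V} (h : J.IsFrame s f)
    {a : ι → ℝ} (ha : ∀ i ∈ s, 0 ≤ a i) : ∃ x, ∑ i ∈ s, a i • f i = J.L x x := by
  refine ⟨∑ i ∈ s, √(a i) • f i, ?_⟩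
  rw [h.mul]
  exact Finset.sum_congr rfl fun i hi => by rw [Real.mul_self_sqrt (ha i hi)]

theorem inner_sq_sq_nonneg [FiniteDimensional ℝ V] (x y : V) :
    0 ≤ inner ℝ (J.L x x) (J.L y y) := by
  obtain ⟨s, f, hf, -, hx⟩ := J.exists_spectral x
  rw [hx, hf.mul]
  exact hf.sum_inner_nonneg (fun i _ => mul_self_nonneg i) y

/-- The cone of squares is self-dual. -/
theorem isSquare_iff [FiniteDimensional ℝ V] (y : V) :
    (∃ x, y = J.L x x) ↔ ∀ x, 0 ≤ inner ℝ y (J.L x x) := by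
  refine ⟨?_, fun h => ?_⟩
  · rintro ⟨x, rfl⟩ z
    exact J.inner_sq_sq_nonneg x z
  obtain ⟨s, f, hf, hf0, hy⟩ := J.exists_spectral y
  rw [hy]
  refine hf.sum_isSquare fun l hl => ?_
  -- As `f l` is its own square, testing against it reads off the sign of the coefficient `l`.
  have h1 := h (f l)
  rw [hf.idempotent l hl, hy, hf.inner_sum _ hl] at h1
  exact nonneg_of_mul_nonneg_left h1 (real_inner_self_pos.2 (hf0 l hl))

/-- For `y` near `x² + εe` with spectral idempotent `f`, the coefficient is `⟨y, f⟩ / ‖f‖²`. The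
part `εe` contributes exactly `ε`, and the error `h` contributes at most `C‖h‖` because `⟨h, f⟩ =
⟨hf, f⟩`; this bound does not depend on `f`. -/
theorem sq_add_smul_e_mem_cone [FiniteDimensional ℝ V] (x : V) {ε : ℝ} (hε : 0 < ε) :
    J.L x x + ε • J.e ∈ J.cone := by
  obtain ⟨C, hC⟩ : ∃ C : ℝ, ∀ h c : V, inner ℝ (J.L h c) c ≤ C * ‖h‖ * ‖c‖ ^ 2 := by
    let B : V →ₗ[ℝ] V →L[ℝ] V := LinearMap.toContinuousLinearMap.toLinearMap ∘ₗ J.L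
    refine ⟨‖LinearMap.toContinuousLinearMap B‖, fun h c => ?_⟩
    have h1 : ‖J.L h c‖ ≤ ‖LinearMap.toContinuousLinearMap B‖ * ‖h‖ * ‖c‖ :=
      (LinearMap.toContinuousLinearMap B).le_opNorm₂ h c
    calc inner ℝ (J.L h c) c ≤ ‖J.L h c‖ * ‖c‖ := real_inner_le_norm _ _
      _ ≤ _ := by nlinarith [norm_nonneg c]
  refine mem_interior_iff_mem_nhds.2 (Metric.mem_nhds_iff.2
    ⟨ε / (|C| + 1), by positivity, fun y hy => ?_⟩)
  rw [Metric.mem_ball, dist_eq_norm] at hy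
  obtain ⟨s, f, hf, hf0, hy'⟩ := J.exists_spectral y
  change ∃ x, y = J.L x x
  conv => enter [1, x]; rw [hy']
  refine hf.sum_isSquare fun l hl => ?_
  have h1 : inner ℝ y (f l) = l * inner ℝ (f l) (f l) := by
    conv_lhs => rw [hy', hf.inner_sum _ hl]
  have h2 : 0 ≤ inner ℝ (J.L x x) (f l) := by
    rw [← hf.idempotent l hl]; exact J.inner_sq_sq_nonneg _ _
  have h3 : inner ℝ J.e (f l) = inner ℝ (f l) (f l) := by
    conv_lhs => rw [← hf.idempotent l hl, ← J.inner_L, J.L_e_right]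
  have h4 := hC (-(y - (J.L x x + ε • J.e))) (f l)
  rw [J.L_comm, J.inner_L, hf.idempotent l hl, norm_neg] at h4
  simp only [inner_neg_left, inner_sub_left, inner_add_left, real_inner_smul_left, h1, h3] at h4
  rw [← real_inner_self_eq_norm_sq] at h4
  have h5 := real_inner_self_pos.2 (hf0 l hl)
  have h6 : C * ‖y - (J.L x x + ε • J.e)‖ ≤ ε := by
    rw [lt_div_iff₀ (by positivity)] at hy
    nlinarith [norm_nonneg (y - (J.L x x + ε • J.e)), le_abs_self C]
  by_contra hl0
  push Not at hl0
  nlinarith [mul_le_mul_of_nonneg_right h6 h5.le, mul_pos_of_neg_of_neg hl0 (neg_neg_of_pos h5)]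

theorem cone_subset_squares : J.cone ⊆ {y | ∃ x, y = J.L x x} := interior_subset

/-- The elements of `G(Ω)` preserve the squares. -/
theorem apply_sq_isSquare [FiniteDimensional ℝ V] {g : (V →L[ℝ] V)ˣ} (hg : g ∈ J.coneGroup)
    (x : V) : ∃ y, (g : V →L[ℝ] V) (J.L x x) = J.L y y := by
  rw [isSquare_iff]
  intro z
  -- A square may lie on the boundary of the cone, so it is moved inside by `εe`; self-duality turns
  -- the conclusion into closed inequalities, which survive `ε → 0`.
  have key : ∀ ε : ℝ, 0 < ε → 0 ≤ inner ℝ ((g : V →L[ℝ] V) (J.L x x)) (J.L z z) +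
      ε * inner ℝ ((g : V →L[ℝ] V) J.e) (J.L z z) := by
    intro ε hε
    have h1 : (g : V →L[ℝ] V) (J.L x x + ε • J.e) ∈ J.cone := by
      have hg' : (g : V →L[ℝ] V) '' J.cone = J.cone := hg
      rw [← hg']
      exact ⟨_, J.sq_add_smul_e_mem_cone x hε, rfl⟩
    have := (J.isSquare_iff _).1 (J.cone_subset_squares h1) z
    simpa [inner_add_left, real_inner_smul_left] using this
  have hlim : Filter.Tendsto (fun ε : ℝ => inner ℝ ((g : V →L[ℝ] V) (J.L x x)) (J.L z z) +
      ε * inner ℝ ((g : V →L[ℝ] V) J.e) (J.L z z)) (nhdsWithin 0 (Set.Ioi 0))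
      (nhds (inner ℝ ((g : V →L[ℝ] V) (J.L x x)) (J.L z z))) := by
    have : Continuous (fun ε : ℝ => inner ℝ ((g : V →L[ℝ] V) (J.L x x)) (J.L z z) +
      ε * inner ℝ ((g : V →L[ℝ] V) J.e) (J.L z z)) := by fun_prop
    simpa using (this.tendsto 0).mono_left nhdsWithin_le_nhds
  exact ge_of_tendsto hlim (eventually_mem_nhdsWithin.mono key)

end EuclideanJordanAlgebra

namespace EuclideanJordanAlgebra

variable {V : Type*} [NormedAddCommGroup V] [InnerProductSpace ℝ V]
variable (J : EuclideanJordanAlgebra V)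

/-! ### Automorphisms and the stabilizer of the identity -/

theorem unit_inv_apply (g : (V →L[ℝ] V)ˣ) (x : V) :
    ((g⁻¹ : (V →L[ℝ] V)ˣ) : V →L[ℝ] V) ((g : V →L[ℝ] V) x) = x :=
  DFunLike.congr_fun g.inv_mul x

theorem unit_apply_inv (g : (V →L[ℝ] V)ˣ) (x : V) :
    (g : V →L[ℝ] V) (((g⁻¹ : (V →L[ℝ] V)ˣ) : V →L[ℝ] V) x) = x :=
  DFunLike.congr_fun g.mul_inv x

theorem mul_of_sq {W : Type*} [AddCommGroup W] [Module ℝ W] (A : V →ₗ[ℝ] W)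
    (B : V →ₗ[ℝ] V →ₗ[ℝ] W) (hB : ∀ a b, B a b = B b a) (h : ∀ x, A (J.L x x) = B x x) (a b : V) :
    A (J.L a b) = B a b := by
  have h1 := h (a + b)
  simp only [map_add, LinearMap.add_apply, h, J.L_comm b a, hB b a] at h1
  linear_combination (norm := module) (1 / 2 : ℝ) • h1

theorem mul_eq_zero_of_idempotent_add {c d : V} (hc : J.L c c = c) (hd : J.L d d = d)
    (h : J.L (c + d) (c + d) = c + d) : J.L c d = 0 := by
  simp only [map_add, LinearMap.add_apply, hc, hd, J.L_comm d c] at h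
  linear_combination (norm := module) (1 / 2 : ℝ) • h

theorem idempotent_e_sub {c : V} (hc : J.L c c = c) : J.L (J.e - c) (J.e - c) = J.e - c := by
  simp only [map_sub, LinearMap.sub_apply, hc, J.L_e, J.L_e_right]
  abel

theorem inner_e_sq (x : V) : inner ℝ (J.L x x) J.e = inner ℝ x x := by
  rw [J.inner_L, J.L_e_right]

/-- Elements of `G(Ω)` that fix `e` map idempotents to idempotents. -/
theorem idempotent_apply [FiniteDimensional ℝ V] {g : (V →L[ℝ] V)ˣ} (hg : g ∈ J.coneGroup)
    (hge : (g : V →L[ℝ] V) J.e = J.e) {c : V} (hc : J.L c c = c) :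
    J.L ((g : V →L[ℝ] V) c) ((g : V →L[ℝ] V) c) = (g : V →L[ℝ] V) c := by
  have hig := J.coneGroup.inv_mem hg
  have hige : ((g⁻¹ : (V →L[ℝ] V)ˣ) : V →L[ℝ] V) J.e = J.e := by
    conv_lhs => rw [← hge]
    exact unit_inv_apply g _
  have hec := J.idempotent_e_sub hc
  have hce : inner ℝ c (J.e - c) = (0 : ℝ) := by
    conv_lhs => rw [← hc]
    rw [J.inner_L, map_sub, J.L_e_right, hc, hc, sub_self, inner_zero_right]
  obtain ⟨s, f, hf, hf0, hy⟩ := J.exists_spectral ((g : V →L[ℝ] V) c)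
  obtain ⟨y, hgc⟩ := J.apply_sq_isSquare hg c
  obtain ⟨y', hgc'⟩ := J.apply_sq_isSquare hg (J.e - c)
  rw [hc] at hgc
  rw [hec, map_sub, hge] at hgc'
  have hsum : ∀ l ∈ s, ∑ i ∈ s, (if i = l then 1 else 0 : ℝ) • f i = f l := fun l hl => by
    simp [hl]
  suffices h : ∀ l ∈ s, l * l = l by
    rw [hy, hf.mul]
    exact Finset.sum_congr rfl fun l hl => by rw [h l hl]
  -- Idempotents are the extreme points of the order interval `[0, e]`, which `g` and `g⁻¹`
  -- preserve. Positivity of `gc` and `e - gc` puts the coefficients in `[0, 1]`; it remains to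
  -- exclude the interior values.
  intro l hl
  have hall : ∀ i ∈ s, 0 ≤ i ∧ i ≤ 1 := by
    intro i hi
    have hipos := real_inner_self_pos.2 (hf0 i hi)
    have heli : inner ℝ J.e (f i) = inner ℝ (f i) (f i) := by
      rw [real_inner_comm]
      conv_lhs => rw [← hf.idempotent i hi]
      rw [inner_e_sq]
    constructor
    · have := J.inner_sq_sq_nonneg y (f i)
      rw [← hgc, hy, hf.idempotent i hi, hf.inner_sum _ hi] at this
      exact nonneg_of_mul_nonneg_left this hipos
    · have := J.inner_sq_sq_nonneg y' (f i)
      rw [← hgc', hy, hf.idempotent i hi, inner_sub_left, hf.inner_sum _ hi, heli] at this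
      nlinarith
  by_contra hne
  have hl0 : 0 < l := (hall l hl).1.lt_of_ne fun h => hne (by rw [← h]; simp)
  have hl1 : l < 1 := (hall l hl).2.lt_of_ne fun h => hne (by rw [h]; simp)
  -- If `0 < l < 1`, both `gc - l f` and `e - gc - (1 - l) f` are squares, where `f = f l`.
  obtain ⟨p, hp⟩ := hf.sum_isSquare (a := fun i => i - l * if i = l then 1 else 0) (by
    intro i hi
    split_ifs with h
    · simp [h]
    · simpa using (hall i hi).1)
  obtain ⟨q, hq⟩ := hf.sum_isSquare (a := fun i => (1 - i) - (1 - l) * if i = l then 1 else 0) (by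
    intro i hi
    split_ifs with h
    · simp [h]
    · simpa using (hall i hi).2)
  simp only [sub_smul, Finset.sum_sub_distrib, mul_smul, ← Finset.smul_sum, hsum l hl, one_smul,
    hf.sum_eq, ← hy] at hp hq
  obtain ⟨u, hu⟩ := J.apply_sq_isSquare hig (f l)
  obtain ⟨p', hp'⟩ := J.apply_sq_isSquare hig p
  obtain ⟨q', hq'⟩ := J.apply_sq_isSquare hig q
  rw [hf.idempotent l hl] at hu
  rw [← hp, map_sub, map_smul, unit_inv_apply, hu] at hp'
  rw [← hq] at hq'
  simp only [map_sub, map_smul, unit_inv_apply, hige, hu] at hq'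
  -- With `u² = g⁻¹f`, pairing the pulled-back squares with `e - c` and `c` gives `⟨u², e⟩ ≤ ⟨u², c⟩
  -- ≤ 0`; since `⟨u², e⟩ = ‖u‖²`, this forces `u = 0`.
  have k1 := J.inner_sq_sq_nonneg p' (J.e - c)
  have k2 := J.inner_sq_sq_nonneg q' c
  rw [hec, ← hp', inner_sub_left, hce, real_inner_smul_left, inner_sub_right] at k1
  rw [hc, ← hq', inner_sub_left, real_inner_comm, hce, inner_sub_left, real_inner_smul_left]
    at k2
  have k3 := J.inner_e_sq u
  have k4 : inner ℝ u u ≤ 0 := by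
    have k5 : inner ℝ (J.L u u) c ≤ 0 := by
      by_contra! h
      nlinarith [mul_pos (sub_pos.2 hl1) h]
    by_contra! h
    nlinarith [mul_pos hl0 (sub_pos.2 (k5.trans_lt h))]
  have k5 : u = 0 := by
    rw [← inner_self_eq_zero (𝕜 := ℝ)]
    exact le_antisymm k4 real_inner_self_nonneg
  apply hf0 l hl
  rw [← unit_apply_inv g (f l), hu, k5]
  simp

/-- Automorphisms of the Jordan algebra. -/
def IsAut (g : V →L[ℝ] V) : Prop := ∀ a b, g (J.L a b) = J.L (g a) (g b)

/-- The stabilizer of `e` in `G(Ω)` consists of automorphisms. -/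
theorem isAut_of_mem_fullIsotropy [FiniteDimensional ℝ V] {g : (V →L[ℝ] V)ˣ}
    (hg : g ∈ J.fullIsotropy) : J.IsAut (g : V →L[ℝ] V) := by
  obtain ⟨hg, hge⟩ := hg
  change (g : V →L[ℝ] V) J.e = J.e at hge
  refine J.mul_of_sq ((g : V →L[ℝ] V) : V →ₗ[ℝ] V)
    (J.L.compl₁₂ ((g : V →L[ℝ] V) : V →ₗ[ℝ] V) ((g : V →L[ℝ] V) : V →ₗ[ℝ] V))
    (fun a b => J.L_comm _ _) fun x => ?_
  obtain ⟨s, f, hf, -, hx⟩ := J.exists_spectral x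
  have hgf : J.IsFrame s fun l => (g : V →L[ℝ] V) (f l) := by
    have hid := fun l hl => J.idempotent_apply hg hge (hf.idempotent l hl)
    refine ⟨fun i hi j hj hij => ?_, hid, ?_⟩
    · refine J.mul_eq_zero_of_idempotent_add (hid i hi) (hid j hj) ?_
      rw [← map_add]
      refine J.idempotent_apply hg hge ?_
      simp [hf.idempotent i hi, hf.idempotent j hj, hf.orthogonal i hi j hj hij,
        hf.orthogonal j hj i hi hij.symm]
    · rw [← map_sum, hf.sum_eq, hge]
  change (g : V →L[ℝ] V) (J.L x x) = J.L ((g : V →L[ℝ] V) x) ((g : V →L[ℝ] V) x)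
  have h1 : (g : V →L[ℝ] V) x = ∑ l ∈ s, l • (g : V →L[ℝ] V) (f l) := by
    conv_lhs => rw [hx]
    simp only [map_sum, map_smul]
  rw [h1, hgf.mul]
  conv_lhs => rw [hx, hf.mul]
  simp only [map_sum, map_smul]

variable {J} in
theorem IsAut.map_e {g : (V →L[ℝ] V)ˣ} (hg : J.IsAut (g : V →L[ℝ] V)) :
    (g : V →L[ℝ] V) J.e = J.e := by
  have h := hg J.e (((g⁻¹ : (V →L[ℝ] V)ˣ) : V →L[ℝ] V) J.e)
  rwa [J.L_e, unit_apply_inv, J.L_e_right, eq_comm] at h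

theorem image_cone_of_image_squares {g : (V →L[ℝ] V)ˣ}
    (h : (g : V →L[ℝ] V) '' {y | ∃ x, y = J.L x x} = {y | ∃ x, y = J.L x x}) :
    g ∈ J.coneGroup := by
  change (g : V →L[ℝ] V) '' interior _ = interior _
  conv_rhs => rw [← h]
  exact (ContinuousLinearEquiv.ofUnit g).toHomeomorph.image_interior _

variable {J} in
theorem IsAut.mem_fullIsotropy {g : (V →L[ℝ] V)ˣ} (hg : J.IsAut (g : V →L[ℝ] V)) :
    g ∈ J.fullIsotropy := by
  refine ⟨J.image_cone_of_image_squares ?_, hg.map_e⟩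
  ext y
  constructor
  · rintro ⟨_, ⟨x, rfl⟩, rfl⟩
    exact ⟨_, hg x x⟩
  · rintro ⟨x, rfl⟩
    refine ⟨_, ⟨((g⁻¹ : (V →L[ℝ] V)ˣ) : V →L[ℝ] V) x, rfl⟩, ?_⟩
    rw [hg, unit_apply_inv]

/-! ### One-parameter groups -/

section Exp

variable [FiniteDimensional ℝ V]


/-- The exponential of an operator, as an invertible operator. -/
noncomputable def expUnit (T : V →L[ℝ] V) : (V →L[ℝ] V)ˣ where
  val := NormedSpace.exp T
  inv := NormedSpace.exp (-T)
  val_inv := by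
    have := FiniteDimensional.complete ℝ V
    let := NormedAlgebra.restrictScalars ℚ ℝ (V →L[ℝ] V)
    rw [← NormedSpace.exp_add_of_commute (Commute.refl T).neg_right, add_neg_cancel,
      NormedSpace.exp_zero]
  inv_val := by
    have := FiniteDimensional.complete ℝ V
    let := NormedAlgebra.restrictScalars ℚ ℝ (V →L[ℝ] V)
    rw [← NormedSpace.exp_add_of_commute (Commute.refl T).neg_left, neg_add_cancel,
      NormedSpace.exp_zero]

theorem hasDerivAt_exp_apply (T : V →L[ℝ] V) (v : V) (t : ℝ) :
    HasDerivAt (fun t : ℝ => (NormedSpace.exp (t • T) : V →L[ℝ] V) v)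
      (T ((NormedSpace.exp (t • T) : V →L[ℝ] V) v)) t := by
  have := FiniteDimensional.complete ℝ V
  have h := (hasDerivAt_exp_smul_const' (𝕂 := ℝ) T t).clm_apply (hasDerivAt_const t v)
  simpa using h

theorem continuous_expUnit (T : V →L[ℝ] V) : Continuous fun t : ℝ => expUnit (t • T) := by
  have := FiniteDimensional.complete ℝ V
  have h : Continuous fun t : ℝ => NormedSpace.exp (t • T) :=
    continuous_iff_continuousAt.2 fun t =>
      (hasDerivAt_exp_smul_const' (𝕂 := ℝ) T t).continuousAt
  refine Units.continuous_iff.2 ⟨h, ?_⟩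
  have h2 : Continuous fun t : ℝ => NormedSpace.exp ((-t) • T) := h.comp continuous_neg
  simp only [neg_smul] at h2
  exact h2

/-- A one-parameter group of transformations of the cone lies in the identity component. -/
theorem expUnit_mem_H {T : V →L[ℝ] V} (h : ∀ t : ℝ, expUnit (t • T) ∈ J.coneGroup) (t : ℝ) :
    expUnit (t • T) ∈ J.H := by
  let γ : ℝ → J.coneGroup := fun t => ⟨expUnit (t • T), h t⟩
  have hγ : Continuous γ := (continuous_expUnit T).subtype_mk h
  have hγ0 : γ 0 = 1 := Subtype.ext (Units.ext (by simp [γ, expUnit]))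
  have h1 : γ t ∈ connectedComponent (1 : J.coneGroup) :=
    (isPreconnected_range hγ).subset_connectedComponent ⟨0, hγ0⟩ ⟨t, rfl⟩
  exact ⟨γ t, h1, rfl⟩

theorem mem_lieH_of_expUnit {T : V →L[ℝ] V} (h : ∀ t : ℝ, expUnit (t • T) ∈ J.coneGroup) :
    T ∈ J.lieH := fun t => ⟨_, J.expUnit_mem_H h t, rfl⟩

/-- The scalings by `exp t` preserve the cone; this is what places the fields `X(0, β·1, 0)` in
`𝔤_ℂ`. -/
theorem one_mem_lieH : (1 : V →L[ℝ] V) ∈ J.lieH := by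
  have := FiniteDimensional.complete ℝ V
  refine J.mem_lieH_of_expUnit fun t => J.image_cone_of_image_squares ?_
  have h : ∀ (t : ℝ) (v : V), (expUnit (t • (1 : V →L[ℝ] V)) : V →L[ℝ] V) v = Real.exp t • v := by
    intro t v
    have h1 := NormedSpace.algebraMap_exp_comm (𝔸 := V →L[ℝ] V) t
    rw [Algebra.algebraMap_eq_smul_one, Algebra.algebraMap_eq_smul_one, ← Real.exp_eq_exp_ℝ] at h1
    change (NormedSpace.exp (t • (1 : V →L[ℝ] V)) : V →L[ℝ] V) v = _
    rw [← h1]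
    rfl
  ext y
  constructor
  · rintro ⟨_, ⟨x, rfl⟩, rfl⟩
    refine ⟨Real.exp (t / 2) • x, ?_⟩
    rw [h, map_smul, map_smul, LinearMap.smul_apply, smul_smul, ← Real.exp_add, add_halves]
  · rintro ⟨x, rfl⟩
    refine ⟨_, ⟨Real.exp (-(t / 2)) • x, rfl⟩, ?_⟩
    rw [h, map_smul, map_smul, LinearMap.smul_apply, smul_smul, smul_smul, ← Real.exp_add,
      ← Real.exp_add]
    ring_nf
    simp

/-- Derivations of the Jordan algebra. -/
def IsDer (D : V →L[ℝ] V) : Prop := ∀ a b, D (J.L a b) = J.L (D a) b + J.L a (D b)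

/-- The product as a continuous bilinear map. -/
noncomputable def Lc : V →L[ℝ] V →L[ℝ] V :=
  LinearMap.toContinuousLinearMap (LinearMap.toContinuousLinearMap.toLinearMap ∘ₗ J.L)

@[simp] theorem Lc_apply (a b : V) : J.Lc a b = J.L a b := rfl

-- By the Leibniz rule the product of the curves `exp(tD)a` and `exp(tD)b` solves `w' = Dw`, as
-- `exp(tD)(ab)` does. Uniqueness is seen from `exp(-tD)w(t)`, which has zero derivative.
variable {J} in
theorem IsDer.isAut_exp {D : V →L[ℝ] V} (hD : J.IsDer D) (t : ℝ) :
    J.IsAut (expUnit (t • D) : V →L[ℝ] V) := by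
  have := FiniteDimensional.complete ℝ V
  intro a b
  let u : V → ℝ → V := fun v t => (NormedSpace.exp (t • D) : V →L[ℝ] V) v
  have hu : ∀ v t, HasDerivAt (u v) (D (u v t)) t := fun v t => hasDerivAt_exp_apply D v t
  let w : ℝ → V := fun t => J.L (u a t) (u b t)
  have hw : ∀ t, HasDerivAt w (D (w t)) t := by
    intro t
    have h := ((J.Lc.hasFDerivAt (x := u a t)).comp_hasDerivAt t (hu a t)).clm_apply (hu b t)
    rw [show D (w t) = J.Lc (D (u a t)) (u b t) + J.Lc (u a t) (D (u b t)) from hD _ _]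
    exact h
  have hinv : ∀ t, HasDerivAt (fun t : ℝ => NormedSpace.exp ((-t) • D))
      (-(NormedSpace.exp ((-t) • D) * D)) t := by
    intro t
    have h := (hasDerivAt_exp_smul_const (𝕂 := ℝ) D (-t)).scomp t (hasDerivAt_neg t)
    rw [neg_smul, one_smul] at h
    exact h
  have hf : ∀ t, HasDerivAt (fun t : ℝ => (NormedSpace.exp ((-t) • D) : V →L[ℝ] V) (w t)) 0 t := by
    intro t
    have h := (hinv t).clm_apply (hw t)
    simpa using h
  have hc := is_const_of_deriv_eq_zero (fun t => (hf t).differentiableAt) (fun t => (hf t).deriv) t 0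
  have h0 : (NormedSpace.exp ((-t) • D) : V →L[ℝ] V) (w t) = J.L a b := by
    rw [hc]
    simp [w, u]
  have h1 := unit_apply_inv (expUnit (t • D)) (w t)
  rw [show ((((expUnit (t • D))⁻¹ : (V →L[ℝ] V)ˣ)) : V →L[ℝ] V) = NormedSpace.exp ((-t) • D) by
    rw [neg_smul]; rfl, h0] at h1
  exact h1

variable {J} in
theorem IsDer.expUnit_mem_isotropy {D : V →L[ℝ] V} (hD : J.IsDer D) (t : ℝ) :
    expUnit (t • D) ∈ J.isotropy :=
  ⟨J.expUnit_mem_H (fun t => (hD.isAut_exp t).mem_fullIsotropy.1) t,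
    (hD.isAut_exp t).mem_fullIsotropy.2⟩

theorem apply_eq_zero_of_exp_apply {D : V →L[ℝ] V} {v : V}
    (h : ∀ t : ℝ, (expUnit (t • D) : V →L[ℝ] V) v = v) : D v = 0 := by
  have h1 := hasDerivAt_exp_apply D v 0
  have h2 : (fun t : ℝ => (NormedSpace.exp (t • D) : V →L[ℝ] V) v) = fun _ => v := funext h
  rw [h2] at h1
  simpa using h1.unique (hasDerivAt_const 0 v)

theorem commute_of_exp_commute {D T : V →L[ℝ] V}
    (h : ∀ (t : ℝ) (v : V), (expUnit (t • D) : V →L[ℝ] V) (T v) =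
      T ((expUnit (t • D) : V →L[ℝ] V) v)) (v : V) : D (T v) = T (D v) := by
  have h1 := hasDerivAt_exp_apply D (T v) 0
  have h2 := T.hasFDerivAt.comp_hasDerivAt (0 : ℝ) (hasDerivAt_exp_apply D v 0)
  have h3 : (fun t : ℝ => (NormedSpace.exp (t • D) : V →L[ℝ] V) (T v)) =
      T ∘ fun t : ℝ => (NormedSpace.exp (t • D) : V →L[ℝ] V) v := funext fun t => h t v
  rw [h3] at h1
  simpa using h1.unique h2

end Exp

end EuclideanJordanAlgebra

namespace EuclideanJordanAlgebra

variable {V : Type*} [NormedAddCommGroup V] [InnerProductSpace ℝ V]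
variable (J : EuclideanJordanAlgebra V)

/-! ### The Lie algebra of the automorphism group of the cone -/

theorem idempotent_cubic {c : V} (hc : J.L c c = c) (y : V) :
    (3 : ℝ) • J.L c (J.L c y) = J.L c y + (2 : ℝ) • J.L c (J.L c (J.L c y)) := by
  have h := J.jordan_linearized c y c
  rw [hc, hc, J.L_comm y c, J.L_comm (J.L c y) c] at h
  linear_combination (norm := module) h

/-- A vector orthogonal to the Peirce spaces of `c` for the eigenvalues `0` and `1` lies in the
Peirce space for `1 / 2`. -/
theorem peirce_half {c w : V} (hc : J.L c c = c) (h0 : ∀ y, J.L c y = 0 → inner ℝ w y = (0 : ℝ))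
    (h1 : ∀ y, J.L c y = y → inner ℝ w y = (0 : ℝ)) : (2 : ℝ) • J.L c w = w := by
  have hcub := J.idempotent_cubic hc w
  -- With `L = L(c)`, the vectors `p = (L - 1)(2L - 1)w` and `q = L(2L - 1)w` lie in the eigenspaces
  -- for `0` and `1` by the cubic relation. Symmetry reduces `⟨p, p⟩` and `⟨q, q⟩` to pairings of
  -- `w` with `p` and `q`, so both vanish, and `q - p = 2Lw - w`.
  have hp : (2 : ℝ) • J.L c (J.L c w) - (3 : ℝ) • J.L c w + w = 0 := by
    set p := (2 : ℝ) • J.L c (J.L c w) - (3 : ℝ) • J.L c w + w with hp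
    have hLp : J.L c p = 0 := by
      rw [hp]
      simp only [map_add, map_sub, map_smul]
      linear_combination (norm := module) -hcub
    rw [← inner_self_eq_zero (𝕜 := ℝ)]
    conv_lhs => arg 2; rw [hp]
    simp [inner_add_left, inner_sub_left, real_inner_smul_left, J.inner_L, hLp, h0 p hLp]
  have hq : (2 : ℝ) • J.L c (J.L c w) - J.L c w = 0 := by
    set q := (2 : ℝ) • J.L c (J.L c w) - J.L c w with hq
    have hLq : J.L c q = q := by
      rw [hq]
      simp only [map_sub, map_smul]
      linear_combination (norm := module) -hcub
    rw [← inner_self_eq_zero (𝕜 := ℝ)]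
    conv_lhs => arg 2; rw [hq]
    simp [inner_sub_left, real_inner_smul_left, J.inner_L, hLq, h1 q hLq]
  linear_combination (norm := module) hq - hp

theorem commute_of_mul_eq_zero {c y : V} (hc : J.L c c = c) (hy : J.L c y = 0) (v : V) :
    J.L c (J.L y v) = J.L y (J.L c v) := by
  have h := J.jordan_linearized c y v
  simpa [hc, hy] using h

section FiniteDimensional

variable [FiniteDimensional ℝ V]

/-- The function `t ↦ ⟨exp(tT)x², y²⟩` is nonnegative and vanishes at `0`, so its derivative there
is zero. -/
theorem inner_lieH_apply {T : V →L[ℝ] V} (hT : T ∈ J.lieH) {x y : V}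
    (hxy : inner ℝ (J.L x x) (J.L y y) = (0 : ℝ)) :
    inner ℝ (T (J.L x x)) (J.L y y) = (0 : ℝ) := by
  have hd := (hasDerivAt_exp_apply T (J.L x x) 0).inner ℝ (hasDerivAt_const (0 : ℝ) (J.L y y))
  have hmin : IsLocalMin (fun t : ℝ => inner ℝ ((NormedSpace.exp (t • T) : V →L[ℝ] V) (J.L x x))
      (J.L y y) : ℝ → ℝ) 0 := by
    refine Filter.Eventually.of_forall fun t => ?_
    obtain ⟨g, ⟨g', -, rfl⟩, hgt⟩ := hT t
    obtain ⟨z, hz⟩ := J.apply_sq_isSquare g'.2 x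
    simp only [zero_smul, NormedSpace.exp_zero, one_apply_eq_self, hxy]
    rw [← hgt]
    change 0 ≤ inner ℝ (((g' : (V →L[ℝ] V)ˣ) : V →L[ℝ] V) (J.L x x)) (J.L y y)
    rw [hz]
    exact J.inner_sq_sq_nonneg _ _
  simpa using hmin.hasDerivAt_eq_zero hd

/-- The hypothesis is the Leibniz rule for `c = c²`. Applied to the idempotent `f i + f j` it kills
the cross terms, so the rule holds for every square by the spectral decomposition, and then for
products by polarization. -/
theorem isDer_of_idempotent {D : V →L[ℝ] V}
    (hD : ∀ c, J.L c c = c → (2 : ℝ) • J.L c (D c) = D c) : J.IsDer D := by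
  intro a b
  refine J.mul_of_sq (D : V →ₗ[ℝ] V)
    (J.L.compl₁₂ (D : V →ₗ[ℝ] V) LinearMap.id + J.L.compl₁₂ LinearMap.id (D : V →ₗ[ℝ] V))
    (fun a b => ?_) (fun x => ?_) a b
  · simp [J.L_comm (D a) b, J.L_comm a (D b), add_comm]
  obtain ⟨s, f, hf, -, hx⟩ := J.exists_spectral x
  have hcross : ∀ i ∈ s, ∀ j ∈ s, i ≠ j → J.L (f i) (D (f j)) + J.L (f j) (D (f i)) = 0 := by
    intro i hi j hj hij
    have h1 := hD (f i + f j) (by simp [hf.idempotent i hi, hf.idempotent j hj,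
      hf.orthogonal i hi j hj hij, hf.orthogonal j hj i hi hij.symm])
    have h2 := hD _ (hf.idempotent i hi)
    have h3 := hD _ (hf.idempotent j hj)
    simp only [map_add, LinearMap.add_apply] at h1
    linear_combination (norm := module) (1 / 2 : ℝ) • (h1 - h2 - h3)
  have h1 : D x = ∑ l ∈ s, l • D (f l) := by
    conv_lhs => rw [hx]
    simp only [map_sum, map_smul]
  have h2 : J.L x (D x) = ∑ i ∈ s, ∑ j ∈ s, (i * j) • J.L (f i) (D (f j)) := by
    rw [h1]
    conv_lhs => rw [hx]
    simp only [map_sum, map_smul, LinearMap.sum_apply, LinearMap.smul_apply, Finset.smul_sum,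
      smul_smul]
    rw [Finset.sum_comm]
    exact Finset.sum_congr rfl fun i _ => Finset.sum_congr rfl fun j _ => by rw [mul_comm]
  have h3 : D (J.L x x) = ∑ i ∈ s, (i * i) • D (f i) := by
    conv_lhs => rw [hx, hf.mul]
    simp only [map_sum, map_smul]
  have h4 : (2 : ℝ) • J.L x (D x) = D (J.L x x) := by
    have h5 : J.L x (D x) = ∑ i ∈ s, ∑ j ∈ s, (i * j) • J.L (f j) (D (f i)) := by
      rw [h2, Finset.sum_comm]
      exact Finset.sum_congr rfl fun i _ => Finset.sum_congr rfl fun j _ => by rw [mul_comm]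
    rw [two_smul]
    nth_rewrite 1 [h2]
    rw [h5, h3, ← Finset.sum_add_distrib]
    refine Finset.sum_congr rfl fun i hi => ?_
    rw [← Finset.sum_add_distrib, Finset.sum_eq_single i]
    · rw [← smul_add, ← two_smul ℝ, hD _ (hf.idempotent i hi)]
    · intro j hj hji
      rw [← smul_add, hcross i hi j hj hji.symm, smul_zero]
    · exact fun h => absurd hi h
  rw [two_smul] at h4
  simp only [LinearMap.add_apply, LinearMap.compl₁₂_apply, LinearMap.id_apply,
    ContinuousLinearMap.coe_coe]
  rw [J.L_comm (D x) x, h4]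

/-- An element of `𝔥` is the sum of a multiplication and a derivation. -/
theorem isDer_sub_of_mem_lieH {T : V →L[ℝ] V} (hT : T ∈ J.lieH) :
    J.IsDer (T - J.Lc (T J.e)) := by
  set D := T - J.Lc (T J.e) with hDdef
  have hDe : D J.e = 0 := by simp [hDdef, J.L_e_right]
  have h0 : ∀ c, J.L c c = c → ∀ y, J.L c y = 0 → inner ℝ (D c) (J.L y y) = (0 : ℝ) := by
    intro c hc y hy
    have h1 : J.L c (J.L y y) = 0 := by rw [J.commute_of_mul_eq_zero hc hy, hy, map_zero]
    have h2 : inner ℝ (T (J.L c c)) (J.L y y) = (0 : ℝ) :=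
      J.inner_lieH_apply hT (by rw [hc, ← J.inner_L, J.L_comm y c, hy, inner_zero_left])
    rw [hc] at h2
    simp only [hDdef, sub_apply, inner_sub_left, h2, Lc_apply]
    rw [J.L_comm, J.inner_L, h1, inner_zero_right, sub_zero]
  -- The previous orthogonality is to squares `y²` only; replacing `y` by `y + (e - c)` adds the
  -- cross term `2y`, which gives orthogonality to `y` itself.
  have h1 : ∀ c, J.L c c = c → ∀ y, J.L c y = 0 → inner ℝ (D c) y = (0 : ℝ) := by
    intro c hc y hy
    have hce : J.L c (J.e - c) = 0 := by rw [map_sub, J.L_e_right, hc, sub_self]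
    have k1 := h0 c hc (y + (J.e - c)) (by rw [map_add, hy, hce, add_zero])
    have k2 := h0 c hc y hy
    have k3 := h0 c hc _ hce
    have k4 : J.L y (J.e - c) = y := by rw [map_sub, J.L_e_right, J.L_comm, hy, sub_zero]
    simp only [map_add, LinearMap.add_apply, inner_add_right, J.L_comm (J.e - c) y, k4, k2, k3] at k1
    linarith
  -- The Peirce space of `c` for `1` is that of `e - c` for `0`, and `D(e - c) = -Dc`.
  refine J.isDer_of_idempotent fun c hc => J.peirce_half hc (h1 c hc) fun y hy => ?_
  have := h1 _ (J.idempotent_e_sub hc) y (by rw [map_sub, LinearMap.sub_apply, J.L_e, hy, sub_self])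
  rw [map_sub, hDe, zero_sub, inner_neg_left, neg_eq_zero] at this
  exact this

/-! ### Derivations -/

omit [FiniteDimensional ℝ V] in
variable {J} in
theorem IsDer.map_e {D : V →L[ℝ] V} (hD : J.IsDer D) : D J.e = 0 := by
  have h := hD J.e J.e
  simpa [J.L_e, J.L_e_right] using h

variable {J} in
theorem IsDer.inner_map_e {D : V →L[ℝ] V} (hD : J.IsDer D) (x : V) :
    inner ℝ (D x) J.e = (0 : ℝ) := by
  have hidem : ∀ c, J.L c c = c → inner ℝ (D c) J.e = (0 : ℝ) := by
    intro c hc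
    have h1 := hD c c
    rw [hc, J.L_comm (D c)] at h1
    have h2 : inner ℝ (D c) J.e = 2 * inner ℝ (D c) c := by
      conv_lhs => rw [h1, inner_add_left, J.inner_L, J.L_e_right]
      ring
    have h3 : inner ℝ (D c) c = 2 * inner ℝ (D c) c := by
      conv_lhs => rw [h1, inner_add_left, J.inner_L, hc]
      ring
    linarith
  obtain ⟨s, f, hf, -, hx⟩ := J.exists_spectral x
  rw [hx]
  simp only [map_sum, map_smul, sum_inner, real_inner_smul_left]
  exact Finset.sum_eq_zero fun l hl => by rw [hidem _ (hf.idempotent l hl), mul_zero]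

-- Since `⟨xy, e⟩ = ⟨x, y⟩`, the Leibniz rule for `D(xy)` paired with `e` gives skewness.
variable {J} in
theorem IsDer.skew {D : V →L[ℝ] V} (hD : J.IsDer D) (x y : V) :
    inner ℝ (D x) y = -inner ℝ x (D y) := by
  have h := hD.inner_map_e (J.L x y)
  rw [hD, inner_add_left, J.L_comm (D x), J.inner_L, J.inner_L, J.L_e_right, J.L_e_right,
    real_inner_comm x] at h
  linear_combination h

/-- The inner derivation `[L(a), L(b)]`. -/
noncomputable def innerDer (a b : V) : V →L[ℝ] V := J.Lc a * J.Lc b - J.Lc b * J.Lc a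

theorem innerDer_apply (a b v : V) :
    J.innerDer a b v = J.L a (J.L b v) - J.L b (J.L a v) := rfl

/-- Exchanging `a` and `b` leaves the left side of `jordan_linearized₂` unchanged; equating the two
right sides is the Leibniz rule. -/
theorem isDer_innerDer (a b : V) : J.IsDer (J.innerDer a b) := by
  intro x y
  simp only [innerDer_apply, map_sub, LinearMap.sub_apply]
  have h1 := J.jordan_linearized₂ a x y b
  have h2 := J.jordan_linearized₂ b x y a
  simp only [J.L_comm (J.L a x) b, J.L_comm (J.L a y) b, J.L_comm (J.L b x) a,
    J.L_comm (J.L b y) a, J.L_comm (J.L x y) b, J.L_comm (J.L x y) a, J.L_comm y b, J.L_comm x b,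
    J.L_comm y a, J.L_comm x a, J.L_comm b a, J.L_comm (J.L b x) (J.L a y),
    J.L_comm (J.L b y) (J.L a x)] at h1 h2
  rw [J.L_comm (J.L a (J.L b x)) y, J.L_comm (J.L b (J.L a x)) y]
  linear_combination (norm := module) h2 - h1

/-- The pair symmetry of the curvature. -/
theorem inner_innerDer (a b x y : V) :
    inner ℝ (J.innerDer a b x) y = inner ℝ (J.innerDer x y a) b := by
  rw [innerDer_apply, innerDer_apply, inner_sub_left, inner_sub_left, J.inner_L a (J.L b x),
    J.inner_L b (J.L a x), J.inner_L x (J.L y a), J.inner_L y (J.L x a), J.L_comm b x, J.L_comm a y, J.L_comm a x, J.L_comm b y,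
    real_inner_comm (J.L x b)]

/-! ### Consequences of simplicity -/

section Simple

variable {J}

omit [FiniteDimensional ℝ V] in
theorem IsSimple.e_ne_zero (hJ : J.IsSimple) : J.e ≠ 0 := by
  obtain ⟨h, -⟩ := hJ
  obtain ⟨x, hx⟩ := exists_ne (0 : V)
  intro he
  exact hx (by rw [← J.L_e x, he]; simp)

/-- An eigenspace of `L(z)` is an ideal when `L(z)` commutes with all multiplications; a nonzero one
is all of `V`, hence contains `e`. -/
theorem IsSimple.eq_smul_e_of_central (hJ : J.IsSimple) {z : V} (hz : ∀ y v, J.L z (J.L y v) = J.L y (J.L z v)) :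
    ∃ c : ℝ, z = c • J.e := by
  obtain ⟨s, f, hf, hf0, hx⟩ := J.exists_spectral z
  have hs : s.Nonempty := by
    rw [Finset.nonempty_iff_ne_empty]
    rintro rfl
    exact hJ.e_ne_zero (by simpa using hf.sum_eq.symm)
  obtain ⟨l, hl⟩ := hs
  have hzl : J.L z (f l) = l • f l := by
    conv_lhs => rw [hx]
    exact hf.mul_apply _ hl
  rcases hJ.2 (Module.End.eigenspace (J.L z) l) (fun a x h => by
    rw [Module.End.mem_eigenspace_iff] at h ⊢
    rw [hz, h, map_smul]) with h | h
  · have : f l ∈ Module.End.eigenspace (J.L z) l := Module.End.mem_eigenspace_iff.2 hzl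
    rw [h] at this
    exact absurd this (hf0 l hl)
  · have : J.e ∈ Module.End.eigenspace (J.L z) l := h ▸ Submodule.mem_top
    rw [Module.End.mem_eigenspace_iff, J.L_e_right] at this
    exact ⟨l, this⟩

/-- The only vectors killed by all inner derivations are the multiples of `e`. -/
theorem IsSimple.eq_smul_e_of_innerDer (hJ : J.IsSimple) {z : V} (hz : ∀ a b, J.innerDer a b z = 0) :
    ∃ c : ℝ, z = c • J.e := by
  -- By associativity of the inner product, `⟨[L(z), L(y)]v, w⟩ = ⟨[L(v), L(w)]z, y⟩`.
  refine hJ.eq_smul_e_of_central fun y v => ext_inner_right ℝ fun w => ?_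
  have h : J.L v (J.L w z) = J.L w (J.L v z) := sub_eq_zero.1 (hz v w)
  rw [J.inner_L, J.L_comm y v, J.inner_L, J.L_comm z w, ← J.inner_L v, J.inner_L v, h,
    J.L_comm v z, ← J.inner_L w, J.L_comm w y, J.inner_L y, J.inner_L y]
  rw [← J.inner_L y, real_inner_comm]

end Simple

end FiniteDimensional

end EuclideanJordanAlgebra

namespace EuclideanJordanAlgebra

variable {V : Type*} [NormedAddCommGroup V] [InnerProductSpace ℝ V] [FiniteDimensional ℝ V]
variable {J : EuclideanJordanAlgebra V}

/-! ### Irreducibility of the orthogonal complement of the identity -/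

section Irreducible

variable {U W : Submodule ℝ V}

/-- Pair symmetry turns `‖[L(u), L(w)]v‖²` into the pairing of an inner derivation of `u`, still in
`U`, with `w`. -/
theorem innerDer_eq_zero_of_invariant (hUW : ∀ u ∈ U, ∀ w ∈ W, inner ℝ u w = (0 : ℝ))
    (hinv : ∀ a b, ∀ u ∈ U, J.innerDer a b u ∈ U) {u w : V} (hu : u ∈ U) (hw : w ∈ W) (v : V) :
    J.L u (J.L w v) = J.L w (J.L u v) := by
  have h : J.innerDer u w v = 0 := by
    rw [← inner_self_eq_zero (𝕜 := ℝ), inner_innerDer]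
    exact hUW _ (hinv _ _ u hu) w hw
  exact sub_eq_zero.1 h

/-- The `W`-component `w2` of `u²` is central, so a multiple of `e`, so zero. It commutes with `U`
by hypothesis. For `w` in `W`, the linearized Jordan identity gives `[L(w2), L(w)] = 2[L(u),
L(u1)]`, with `u1` the `U`-component of `uw`: the left form vanishes on `U`, the right form on `W`.
-/
theorem inner_sq_eq_zero_of_commute (hJ : J.IsSimple)
    (hWe : ∀ w ∈ W, inner ℝ w J.e = (0 : ℝ))
    (hUW : ∀ u ∈ U, ∀ w ∈ W, inner ℝ u w = (0 : ℝ))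
    (hcomm : ∀ u ∈ U, ∀ w ∈ W, ∀ v, J.L u (J.L w v) = J.L w (J.L u v))
    (hdec : ∀ v, ∃ u ∈ U, ∃ w ∈ W, ∃ c : ℝ, v = u + w + c • J.e) {u w : V}
    (hu : u ∈ U) (hw : w ∈ W) : inner ℝ (J.L u u) w = (0 : ℝ) := by
  obtain ⟨u2, hu2, w2, hw2, β, hβ⟩ := hdec (J.L u u)
  have key : ∀ w ∈ W, ∀ v, J.L w2 (J.L w v) = J.L w (J.L w2 v) := by
    intro w hw v
    obtain ⟨u1, hu1, w1, hw1, α, hα⟩ := hdec (J.L u w)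
    have hlin : ∀ b, J.L w2 (J.L w b) - J.L w (J.L w2 b) =
        (2 : ℝ) • (J.L u (J.L u1 b) - J.L u1 (J.L u b)) := by
      intro b
      have h := J.jordan_linearized u w b
      rw [hα, hβ] at h
      simp only [map_add, LinearMap.add_apply, map_smul, LinearMap.smul_apply, J.L_e] at h
      linear_combination (norm := module) h - hcomm u2 hu2 w hw b +
        (2 : ℝ) • hcomm u hu w1 hw1 b
    obtain ⟨u', hu', w', hw', c, rfl⟩ := hdec v
    have k1 : J.L w2 (J.L w u') - J.L w (J.L w2 u') = 0 := by
      rw [J.L_comm w u', J.L_comm w2 u', ← hcomm u' hu' w2 hw2, ← hcomm u' hu' w hw,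
        J.L_comm w w2, sub_self]
    have k2 : J.L w2 (J.L w w') - J.L w (J.L w2 w') = 0 := by
      rw [hlin, J.L_comm u1 w', J.L_comm u w', hcomm u hu w' hw', hcomm u1 hu1 w' hw',
        J.L_comm u u1, sub_self, smul_zero]
    simp only [map_add, map_smul, J.L_e_right, J.L_comm w w2]
    linear_combination (norm := module) k1 + k2
  obtain ⟨c, hc⟩ := hJ.eq_smul_e_of_central (z := w2) (by
    intro y v
    obtain ⟨u', hu', w', hw', c, rfl⟩ := hdec y
    simp only [map_add, LinearMap.add_apply, map_smul, LinearMap.smul_apply, J.L_e,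
      hcomm u' hu' w2 hw2, key w' hw'])
  have hw20 : w2 = 0 := by
    rw [← inner_self_eq_zero (𝕜 := ℝ)]
    nth_rewrite 2 [hc]
    rw [real_inner_smul_right, hWe w2 hw2, mul_zero]
  rw [hβ, hw20, inner_add_left, inner_add_left, hUW u2 hu2 w hw, real_inner_smul_left,
    real_inner_comm w J.e, hWe w hw, inner_zero_left]
  simp

/-- The orthogonal complement of `e` is irreducible under the inner derivations. -/
theorem IsSimple.irreducible (hJ : J.IsSimple)
    (hUe : ∀ u ∈ U, inner ℝ u J.e = (0 : ℝ)) (hWe : ∀ w ∈ W, inner ℝ w J.e = (0 : ℝ))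
    (hUW : ∀ u ∈ U, ∀ w ∈ W, inner ℝ u w = (0 : ℝ))
    (hinv : ∀ a b, ∀ u ∈ U, J.innerDer a b u ∈ U)
    (hdec : ∀ v, ∃ u ∈ U, ∃ w ∈ W, ∃ c : ℝ, v = u + w + c • J.e) {u w : V}
    (hu : u ∈ U) (hw : w ∈ W) (hu0 : u ≠ 0) : w = 0 := by
  have hcomm : ∀ u ∈ U, ∀ w ∈ W, ∀ v, J.L u (J.L w v) = J.L w (J.L u v) := fun u hu w hw v =>
    innerDer_eq_zero_of_invariant hUW hinv hu hw v
  have hU : ∀ u ∈ U, ∀ w ∈ W, inner ℝ (J.L u u) w = (0 : ℝ) := fun u hu w hw =>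
    inner_sq_eq_zero_of_commute hJ hWe hUW hcomm hdec hu hw
  have hW : ∀ w ∈ W, ∀ u ∈ U, inner ℝ (J.L w w) u = (0 : ℝ) := fun w hw u hu =>
    inner_sq_eq_zero_of_commute hJ hUe (fun w hw u hu => by rw [real_inner_comm, hUW u hu w hw])
      (fun w hw u hu v => (hcomm u hu w hw v).symm) (fun v => by
        obtain ⟨u, hu, w, hw, c, h⟩ := hdec v
        exact ⟨w, hw, u, hu, c, by rw [h, add_comm u w]⟩) hw hu
  -- Polarizing `U² ⊥ W` and `W² ⊥ U` makes `uw` orthogonal to `U`, `W` and `e`.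
  have hzero : ∀ u ∈ U, ∀ w ∈ W, J.L u w = 0 := by
    intro u hu w hw
    rw [← inner_self_eq_zero (𝕜 := ℝ)]
    obtain ⟨u', hu', w', hw', c, h⟩ := hdec (J.L u w)
    nth_rewrite 2 [h]
    have k1 : inner ℝ (J.L u w) u' = (0 : ℝ) := by
      have h1 := hU (u + u') (U.add_mem hu hu') w hw
      have h2 := hU u hu w hw
      have h3 := hU u' hu' w hw
      simp only [map_add, LinearMap.add_apply, inner_add_left, h2, h3, J.L_comm u' u] at h1
      rw [J.inner_L, real_inner_comm]
      linarith
    have k2 : inner ℝ (J.L u w) w' = (0 : ℝ) := by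
      have h1 := hW (w + w') (W.add_mem hw hw') u hu
      have h2 := hW w hw u hu
      have h3 := hW w' hw' u hu
      simp only [map_add, LinearMap.add_apply, inner_add_left, h2, h3, J.L_comm w' w] at h1
      rw [J.L_comm, J.inner_L, real_inner_comm]
      linarith
    have k3 : inner ℝ (J.L u w) J.e = (0 : ℝ) := by
      rw [J.inner_L, J.L_e_right, real_inner_comm, hUW u hu w hw]
    simp [inner_add_right, real_inner_smul_right, k1, k2, k3]
  obtain ⟨u2, hu2, w2, hw2, β, hβ⟩ := hdec (J.L u u)
  have h1 : J.L (J.L u u) w = 0 := by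
    rw [J.L_comm, ← hcomm u hu w hw, J.L_comm w, hzero u hu w hw, map_zero]
  -- Now `u²w = 0` while only the `e`-component `β` of `u²` acts on `w`; and `β‖e‖² = ‖u‖² ≠ 0`.
  have h2 : inner ℝ (J.L (J.L u u) w) w = β * inner ℝ w w := by
    have h4 : inner ℝ (J.L w2 w) w = (0 : ℝ) := by
      have h5 := hU u hu w2 hw2
      rw [hβ, inner_add_left, inner_add_left, hUW u2 hu2 w2 hw2, real_inner_smul_left,
        real_inner_comm w2 J.e, hWe w2 hw2, mul_zero, zero_add, add_zero] at h5
      rw [inner_self_eq_zero.1 h5]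
      simp
    rw [hβ]
    simp only [map_add, LinearMap.add_apply, map_smul, LinearMap.smul_apply, J.L_e,
      hzero u2 hu2 w hw, inner_add_left, h4, real_inner_smul_left]
    simp
  have h3 : inner ℝ u u = β * inner ℝ J.e J.e := by
    rw [← J.inner_e_sq, hβ, inner_add_left, inner_add_left, hUe u2 hu2, hWe w2 hw2,
      real_inner_smul_left]
    ring
  have hβ0 : β ≠ 0 := by
    rintro rfl
    rw [zero_mul, inner_self_eq_zero] at h3
    exact hu0 h3
  rw [h1, inner_zero_left, eq_comm, mul_eq_zero, inner_self_eq_zero] at h2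
  exact h2.resolve_left hβ0

end Irreducible

omit [FiniteDimensional ℝ V] in
theorem IsSimple.inner_e_ne_zero (hJ : J.IsSimple) : inner ℝ J.e J.e ≠ (0 : ℝ) :=
  inner_self_ne_zero.2 hJ.e_ne_zero

/-- Symmetric operators that commute with the inner derivations are scalar on `e^⊥`. -/
theorem IsSimple.exists_scalar (hJ : J.IsSimple) {S : V →ₗ[ℝ] V} (hS : S.IsSymmetric)
    (hSe : S J.e = 0) (hcomm : ∀ a b v, J.innerDer a b (S v) = S (J.innerDer a b v)) :
    ∃ l : ℝ, ∀ x, inner ℝ x J.e = (0 : ℝ) → S x = l • x := by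
  let V₀ : Submodule ℝ V := (ℝ ∙ J.e)ᗮ
  have hV₀ : ∀ x, x ∈ V₀ ↔ inner ℝ x J.e = (0 : ℝ) := fun x => by
    rw [Submodule.mem_orthogonal_singleton_iff_inner_left]
  by_cases hbot : V₀ = ⊥
  · refine ⟨0, fun x hx => ?_⟩
    rw [← hV₀, hbot, Submodule.mem_bot] at hx
    simp [hx]
  have hSV : ∀ x ∈ V₀, S x ∈ V₀ := fun x _ => by
    rw [hV₀, hS, hSe, inner_zero_right]
  have : Nontrivial V₀ := Submodule.nontrivial_iff_ne_bot.2 hbot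
  obtain ⟨x₀, hx₀⟩ := (hS.restrict_invariant hSV).hasEigenvalue_iSup_of_finiteDimensional.exists_hasEigenvector
  generalize hl : (⨆ x : { x : V₀ // x ≠ 0 }, _ : ℝ) = l at hx₀
  have hx₁ : S x₀ = l • (x₀ : V) := congrArg Subtype.val hx₀.apply_eq_smul
  have hx₂ : (x₀ : V) ≠ 0 := fun h => hx₀.2 (Subtype.ext h)
  let U : Submodule ℝ V := V₀ ⊓ Module.End.eigenspace S l
  let W : Submodule ℝ V := V₀ ⊓ Uᗮ
  -- The `l`-eigenspace inside `e^⊥` is invariant and nonzero, so irreducibility annihilates its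
  -- complement.
  refine ⟨l, fun x hx => ?_⟩
  have hxV := (hV₀ x).2 hx
  obtain ⟨u, hu, w, hw, rfl⟩ := Submodule.exists_add_mem_mem_orthogonal (K := U) x
  have hwW : w ∈ W := ⟨by simpa using V₀.sub_mem hxV hu.1, hw⟩
  have hw0 : w = 0 := by
    refine hJ.irreducible (U := U) (W := W) (fun u hu => (hV₀ u).1 hu.1) (fun w hw => (hV₀ w).1 hw.1)
      (fun u hu w hw => hw.2 u hu) (fun a b u hu => ⟨?_, ?_⟩) (fun v => ?_)
      ⟨x₀.2, Module.End.mem_eigenspace_iff.2 hx₁⟩ hwW hx₂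
    · rw [SetLike.mem_coe, hV₀]
      exact (J.isDer_innerDer a b).inner_map_e u
    · rw [SetLike.mem_coe, Module.End.mem_eigenspace_iff, ← hcomm, Module.End.mem_eigenspace_iff.1 hu.2, map_smul]
    · let c := inner ℝ v J.e / inner ℝ J.e J.e
      have hv : v - c • J.e ∈ V₀ := by
        rw [hV₀, inner_sub_left, real_inner_smul_left, div_mul_cancel₀ _ hJ.inner_e_ne_zero,
          sub_self]
      obtain ⟨u, hu, w, hw, h⟩ := Submodule.exists_add_mem_mem_orthogonal (K := U) (v - c • J.e)
      refine ⟨u, hu, w, ⟨?_, hw⟩, c, ?_⟩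
      · have := V₀.sub_mem hv hu.1
        rw [h] at this
        simpa using this
      · rw [← h]; simp
  rw [hw0, add_zero]
  exact Module.End.mem_eigenspace_iff.1 hu.2

/-! ### Derivations that commute with the inner derivations -/

/-- If a nonzero derivation commutes with the inner derivations, then `V` is a spin factor. -/
theorem IsSimple.mul_of_central_derivation (hJ : J.IsSimple) {D : V →L[ℝ] V} (hD : J.IsDer D)
    (hcomm : ∀ a b v, J.innerDer a b (D v) = D (J.innerDer a b v)) {a : V} (ha : D a ≠ 0) {x y : V}
    (hx : inner ℝ x J.e = (0 : ℝ)) (hy : inner ℝ y J.e = (0 : ℝ)) :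
    J.L x y = (inner ℝ x y / inner ℝ J.e J.e : ℝ) • J.e := by
  obtain ⟨l, hl⟩ := hJ.exists_scalar (S := (D ∘L D : V →L[ℝ] V))
    (fun x y => by simp [hD.skew]) (by simp [hD.map_e]) (by simp [hcomm])
  replace hl : ∀ x, inner ℝ x J.e = (0 : ℝ) → D (D x) = l • x := hl
  have hDD : ∀ v, D (D (D v)) = l • D v := fun v => hl _ (hD.inner_map_e v)
  have hker : ∀ v, D (D v) = 0 → D v = 0 := fun v hv => by
    rw [← inner_self_eq_zero (𝕜 := ℝ), hD.skew, hv, inner_zero_right, neg_zero]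
  have hl0 : l ≠ 0 := by
    rintro rfl
    exact ha (hker _ (hker _ (by rw [hDD, zero_smul])))
  set m := J.L x y with hm
  set n := J.L (D x) (D y) with hn
  have h1 : D (D m) = (2 * l) • m + (2 : ℝ) • n := by
    simp only [hm, hn, hD _ _, map_add, hl x hx, hl y hy, map_smul, LinearMap.smul_apply]
    module
  have h2 : D (D n) = (2 * l) • n + (2 * l ^ 2) • m := by
    simp only [hm, hn, hD _ _, map_add, hl x hx, hl y hy, map_smul, LinearMap.smul_apply]
    module
  have h3 := congrArg (fun v => D (D v)) h1
  have h4 := congrArg (fun v => D (D v)) h2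
  simp only [map_add, map_smul, hDD (D m), hDD (D n)] at h3 h4
  -- On formal combinations of `m` and `n`, `h1` and `h2` give `D²` the eigenvalues `0` and `4l`;
  -- but on `V` it has only `0` and `l`, so `D²m = 0`.
  have h5 : (3 * l ^ 2) • D (D m) = 0 := by
    linear_combination (norm := module) l • h3 - (2 : ℝ) • h4
  have h6 : D m = 0 := hker _ ((smul_eq_zero.1 h5).resolve_left (by simpa using hl0))
  let c := inner ℝ m J.e / inner ℝ J.e J.e
  have hv : inner ℝ (m - c • J.e) J.e = (0 : ℝ) := by
    rw [inner_sub_left, real_inner_smul_left, div_mul_cancel₀ _ hJ.inner_e_ne_zero, sub_self]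
  have h7 := hl _ hv
  rw [map_sub, h6, map_smul, hD.map_e, smul_zero, sub_zero, map_zero, eq_comm, smul_eq_zero] at h7
  have h8 : m = c • J.e := sub_eq_zero.1 (h7.resolve_left hl0)
  rw [h8]
  simp only [c]
  rw [hm, J.L_comm, J.inner_L, J.L_e_right, real_inner_comm]

/-- If `D ≠ 0`, then `V` is a spin factor, and `e`, `a`, `Da` are orthogonal and do not span `V`.
For `b ≠ 0` orthogonal to all three, `[L(a), L(b)]` kills `Db` but sends `b` to a nonzero multiple
of `a`, so commuting with `D` would give `Da = 0`. -/
theorem IsSimple.derivation_eq_zero_of_commute (hJ : J.IsSimple) (hdim : Module.finrank ℝ V ≠ 3)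
    {D : V →L[ℝ] V} (hD : J.IsDer D)
    (hcomm : ∀ a b v, J.innerDer a b (D v) = D (J.innerDer a b v)) : D = 0 := by
  ext a₀
  by_contra ha₀
  change D a₀ ≠ 0 at ha₀
  have hspin := fun x y hx hy => hJ.mul_of_central_derivation hD hcomm ha₀ (x := x) (y := y) hx hy
  have hne := hJ.inner_e_ne_zero
  let c := inner ℝ a₀ J.e / inner ℝ J.e J.e
  obtain ⟨a, hae, ha⟩ : ∃ a, inner ℝ a J.e = (0 : ℝ) ∧ D a ≠ 0 :=
    ⟨a₀ - c • J.e, by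
      rw [inner_sub_left, real_inner_smul_left, div_mul_cancel₀ _ hne, sub_self],
      by simpa [hD.map_e] using ha₀⟩
  have ha0 : a ≠ 0 := fun h => ha (by rw [h, map_zero])
  have haD : inner ℝ a (D a) = (0 : ℝ) := by
    have := hD.skew a a
    rw [real_inner_comm] at this
    linarith
  let f : Fin 3 → V := ![J.e, a, D a]
  have hli : LinearIndependent ℝ f := by
    refine linearIndependent_of_ne_zero_of_inner_eq_zero (𝕜 := ℝ) (fun i => ?_) (fun i j hij => ?_)
    · fin_cases i
      · exact hJ.e_ne_zero
      · exact ha0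
      · exact ha
    · have hDe := hD.inner_map_e a
      have hae' : inner ℝ J.e a = (0 : ℝ) := by rw [real_inner_comm, hae]
      have hDe' : inner ℝ J.e (D a) = (0 : ℝ) := by rw [real_inner_comm, hDe]
      have haD' : inner ℝ (D a) a = (0 : ℝ) := by rw [real_inner_comm, haD]
      fin_cases i <;> fin_cases j <;> first | exact absurd rfl hij | assumption
  have hfr : Module.finrank ℝ (Submodule.span ℝ (Set.range f)) = 3 := by
    simpa using finrank_span_eq_card hli
  have hbot : (Submodule.span ℝ (Set.range f))ᗮ ≠ ⊥ := by
    intro h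
    rw [Submodule.orthogonal_eq_bot_iff] at h
    rw [h, finrank_top] at hfr
    exact hdim hfr
  obtain ⟨b, hb, hb0⟩ := Submodule.exists_mem_ne_zero_of_ne_bot hbot
  have hbf : ∀ i, inner ℝ (f i) b = (0 : ℝ) := fun i => hb _ (Submodule.subset_span ⟨i, rfl⟩)
  have hbe : inner ℝ b J.e = (0 : ℝ) := by rw [real_inner_comm]; exact hbf 0
  have hab : J.L a b = 0 := by
    rw [hspin a b hae hbe, show inner ℝ a b = (0 : ℝ) from hbf 1]; simp
  have hDbb : J.L (D b) b = 0 := by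
    have : inner ℝ (D b) b = (0 : ℝ) := by
      have := hD.skew b b
      rw [real_inner_comm] at this
      rw [real_inner_comm]
      linarith
    rw [hspin _ b (hD.inner_map_e b) hbe, this]; simp
  have haDb : J.L a (D b) = 0 := by
    rw [hspin a _ hae (hD.inner_map_e b), ← neg_eq_iff_eq_neg.2 (hD.skew a b),
      show inner ℝ (D a) b = (0 : ℝ) from hbf 2]
    simp
  have hDbb' : D (J.L b b) = 0 := by rw [hD, J.L_comm b, hDbb, add_zero]
  have h1 := hcomm a b b
  rw [innerDer_apply, innerDer_apply, J.L_comm b (D b), hDbb, haDb, hab, map_zero, map_zero,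
    sub_zero, sub_zero, hD, hDbb', map_zero, add_zero, eq_comm] at h1
  rw [hspin b b hbe hbe, map_smul, J.L_e_right, smul_eq_zero] at h1
  exact h1.elim (div_ne_zero (inner_self_ne_zero.2 hb0) hne) ha

/-- In a spin factor every isometry that fixes `e` is an automorphism. The reflection that negates
`a` fixes `Da`, which is orthogonal to `a`; commuting with `D` gives `Da = -Da`. -/
theorem IsSimple.derivation_eq_zero_of_commute_isAut (hJ : J.IsSimple)
    {D : V →L[ℝ] V} (hD : J.IsDer D)
    (hcomm : ∀ a b v, J.innerDer a b (D v) = D (J.innerDer a b v))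
    (hcomm' : ∀ g : (V →L[ℝ] V)ˣ, J.IsAut (g : V →L[ℝ] V) → ∀ v,
      (g : V →L[ℝ] V) (D v) = D ((g : V →L[ℝ] V) v)) : D = 0 := by
  ext a₀
  by_contra ha₀
  change D a₀ ≠ 0 at ha₀
  have hspin := fun x y hx hy => hJ.mul_of_central_derivation hD hcomm ha₀ (x := x) (y := y) hx hy
  have hne := hJ.inner_e_ne_zero
  have hdec : ∀ x, ∃ (c : ℝ) (x' : V), inner ℝ x' J.e = (0 : ℝ) ∧ x = c • J.e + x' := fun x =>
    ⟨inner ℝ x J.e / inner ℝ J.e J.e, x - (inner ℝ x J.e / inner ℝ J.e J.e) • J.e, by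
      rw [inner_sub_left, real_inner_smul_left, div_mul_cancel₀ _ hne, sub_self], by abel⟩
  obtain ⟨c, a, hae, rfl⟩ := hdec a₀
  rw [map_add, map_smul, hD.map_e, smul_zero, zero_add] at ha₀
  let r : V ≃ₗᵢ[ℝ] V := (ℝ ∙ a)ᗮ.reflection
  let g : (V →L[ℝ] V)ˣ := ContinuousLinearEquiv.toUnit r.toContinuousLinearEquiv
  have hge : r J.e = J.e := Submodule.reflection_mem_subspace_eq_self
    ((Submodule.mem_orthogonal_singleton_iff_inner_right).2 hae)
  have hr0 : ∀ x, inner ℝ x J.e = (0 : ℝ) → inner ℝ (r x) J.e = (0 : ℝ) := fun x hx => by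
    conv_lhs => rw [← hge]
    rw [r.inner_map_map, hx]
  have hg : J.IsAut (g : V →L[ℝ] V) := by
    intro x y
    change r (J.L x y) = J.L (r x) (r y)
    obtain ⟨p, x, hx, rfl⟩ := hdec x
    obtain ⟨q, y, hy, rfl⟩ := hdec y
    simp only [map_add, map_smul, LinearMap.add_apply, LinearMap.smul_apply, J.L_e, J.L_e_right,
      hge, hspin x y hx hy, hspin _ _ (hr0 x hx) (hr0 y hy), r.inner_map_map]
  have hra : r a = -a := Submodule.reflection_orthogonalComplement_singleton_eq_neg a
  have hrD : r (D a) = D a := Submodule.reflection_mem_subspace_eq_self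
    ((Submodule.mem_orthogonal_singleton_iff_inner_right).2 (by
      have := hD.skew a a
      rw [real_inner_comm] at this
      linarith))
  have h : r (D a) = D (r a) := hcomm' g hg a
  rw [hrD, hra, map_neg] at h
  have h2 : (2 : ℝ) • D a = 0 := by rw [two_smul]; nth_rewrite 1 [h]; exact neg_add_cancel _
  exact ha₀ ((smul_eq_zero.1 h2).resolve_left two_ne_zero)

end EuclideanJordanAlgebra

namespace EuclideanJordanAlgebra

variable {V : Type*} [NormedAddCommGroup V] [InnerProductSpace ℝ V]

/-! ### Real and imaginary parts -/

/-- The real part on `V_ℂ`. -/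
noncomputable def rePart : ℂ ⊗[ℝ] V →ₗ[ℝ] V :=
  (TensorProduct.lid ℝ V).toLinearMap ∘ₗ Complex.reLm.rTensor V

/-- The imaginary part on `V_ℂ`. -/
noncomputable def imPart : ℂ ⊗[ℝ] V →ₗ[ℝ] V :=
  (TensorProduct.lid ℝ V).toLinearMap ∘ₗ Complex.imLm.rTensor V

@[simp] theorem rePart_tmul (c : ℂ) (v : V) : rePart (c ⊗ₜ[ℝ] v) = c.re • v := by simp [rePart]

@[simp] theorem imPart_tmul (c : ℂ) (v : V) : imPart (c ⊗ₜ[ℝ] v) = c.im • v := by simp [imPart]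

theorem tmul_rePart_add (z : ℂ ⊗[ℝ] V) :
    (1 : ℂ) ⊗ₜ[ℝ] rePart z + Complex.I ⊗ₜ[ℝ] imPart z = z := by
  induction z using TensorProduct.induction_on with
  | zero => simp
  | tmul c v =>
    rw [rePart_tmul, imPart_tmul, ← TensorProduct.smul_tmul, ← TensorProduct.smul_tmul,
      ← TensorProduct.add_tmul]
    congr 1
    apply Complex.ext <;> simp
  | add a b ha hb =>
    conv_rhs => rw [← ha, ← hb]
    simp only [map_add, TensorProduct.tmul_add]
    abel

@[simp] theorem extC_tmul (T : V →L[ℝ] V) (c : ℂ) (v : V) :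
    extC T (c ⊗ₜ[ℝ] v) = c ⊗ₜ[ℝ] T v := rfl

theorem rePart_extC (T : V →L[ℝ] V) (z : ℂ ⊗[ℝ] V) : rePart (extC T z) = T (rePart z) := by
  induction z using TensorProduct.induction_on with
  | zero => simp
  | tmul c v => simp
  | add a b ha hb => simp [ha, hb]

theorem imPart_extC (T : V →L[ℝ] V) (z : ℂ ⊗[ℝ] V) : imPart (extC T z) = T (imPart z) := by
  induction z using TensorProduct.induction_on with
  | zero => simp
  | tmul c v => simp
  | add a b ha hb => simp [ha, hb]

theorem extC_one : extC (1 : V →L[ℝ] V) = 1 := by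
  ext v
  simp

theorem extC_add (S T : V →L[ℝ] V) : extC (S + T) = extC S + extC T := by
  ext v
  simp [TensorProduct.tmul_add]

theorem extC_smul (c : ℝ) (T : V →L[ℝ] V) : extC (c • T) = (c : ℂ) • extC T := by
  ext v
  simp [TensorProduct.smul_tmul', TensorProduct.tmul_smul]

theorem extC_inv_apply (k : (V →L[ℝ] V)ˣ) (z : ℂ ⊗[ℝ] V) :
    extC ((k⁻¹ : (V →L[ℝ] V)ˣ) : V →L[ℝ] V) (extC (k : V →L[ℝ] V) z) = z := by
  induction z using TensorProduct.induction_on with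
  | zero => simp
  | tmul c v => simp only [extC_tmul, unit_inv_apply]
  | add a b ha hb => simp [ha, hb]

theorem extC_apply_inv (k : (V →L[ℝ] V)ˣ) (z : ℂ ⊗[ℝ] V) :
    extC (k : V →L[ℝ] V) (extC ((k⁻¹ : (V →L[ℝ] V)ˣ) : V →L[ℝ] V) z) = z := by
  induction z using TensorProduct.induction_on with
  | zero => simp
  | tmul c v => simp only [extC_tmul, unit_apply_inv]
  | add a b ha hb => simp [ha, hb]

variable (J : EuclideanJordanAlgebra V)

@[simp] theorem LC_tmul (a b : ℂ) (x y : V) :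
    J.LC (a ⊗ₜ[ℝ] x) (b ⊗ₜ[ℝ] y) = (a * b) ⊗ₜ[ℝ] J.L x y := by
  simp [LC]

theorem LC_comm (z w : ℂ ⊗[ℝ] V) : J.LC z w = J.LC w z := by
  induction z using TensorProduct.induction_on with
  | zero => simp
  | add a b ha hb => simp [ha, hb]
  | tmul c v =>
    induction w using TensorProduct.induction_on with
    | zero => simp
    | add a b ha hb => simp [ha, hb]
    | tmul d u => rw [LC_tmul, LC_tmul, mul_comm, J.L_comm]

theorem LC_eC : J.LC J.eC = 1 := by
  ext v
  simp [eC, J.L_e]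

theorem LC_eC_right (z : ℂ ⊗[ℝ] V) : J.LC z J.eC = z := by
  rw [LC_comm, LC_eC]; rfl

theorem P_apply (z w : ℂ ⊗[ℝ] V) :
    J.P z w = (2 : ℂ) • J.LC z (J.LC z w) - J.LC (J.LC z z) w := rfl

theorem P_eC_right (z : ℂ ⊗[ℝ] V) : J.P z J.eC = J.LC z z := by
  rw [P_apply, LC_eC_right, LC_eC_right, two_smul, add_sub_cancel_right]

theorem P_eC_left (w : ℂ ⊗[ℝ] V) : J.P J.eC w = w := by
  simp only [P_apply, LC_eC, Module.End.one_apply]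
  rw [two_smul, add_sub_cancel_right]

theorem P_neg (z w : ℂ ⊗[ℝ] V) : J.P (-z) w = J.P z w := by
  simp [P_apply]

theorem X_apply (z : ℂ ⊗[ℝ] V) (T : Module.End ℂ (ℂ ⊗[ℝ] V)) (w ζ : ℂ ⊗[ℝ] V) :
    J.X (z, T, w) ζ = z + T ζ - J.P ζ w := rfl

variable {J}

theorem IsAut.extC_LC {g : V →L[ℝ] V} (hg : J.IsAut g) (z w : ℂ ⊗[ℝ] V) :
    extC g (J.LC z w) = J.LC (extC g z) (extC g w) := by
  induction z using TensorProduct.induction_on with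
  | zero => simp
  | add a b ha hb => simp [ha, hb]
  | tmul c v =>
    induction w using TensorProduct.induction_on with
    | zero => simp
    | add a b ha hb => simp [ha, hb]
    | tmul d u => simp [hg v u]

theorem IsAut.extC_P {g : V →L[ℝ] V} (hg : J.IsAut g) (z w : ℂ ⊗[ℝ] V) :
    extC g (J.P z w) = J.P (extC g z) (extC g w) := by
  simp only [P_apply, map_sub, map_smul, hg.extC_LC]

theorem IsAut.Ad_X {k : (V →L[ℝ] V)ˣ} (hk : J.IsAut (k : V →L[ℝ] V)) (z : ℂ ⊗[ℝ] V)
    (T : Module.End ℂ (ℂ ⊗[ℝ] V)) (w : ℂ ⊗[ℝ] V) :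
    Ad k (J.X (z, T, w)) = J.X (extC (k : V →L[ℝ] V) z,
      extC (k : V →L[ℝ] V) * T * extC ((k⁻¹ : (V →L[ℝ] V)ˣ) : V →L[ℝ] V),
      extC (k : V →L[ℝ] V) w) := by
  funext ζ
  simp only [Ad, X_apply, map_add, map_sub, hk.extC_P, extC_apply_inv, Module.End.mul_apply]

/-- The triple `(z, T, w)` is determined by the vector field `X(z, T, w)`. -/
theorem X_injective : Function.Injective J.X := by
  rw [← LinearMap.ker_eq_bot, LinearMap.ker_eq_bot']
  rintro ⟨z, T, w⟩ h
  have h0 : ∀ ζ, z + T ζ - J.P ζ w = 0 := fun ζ => congrFun h ζ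
  have hz : z = 0 := by simpa [P_apply] using h0 0
  -- At `±e` the term `Tζ` is odd and `P(ζ)w = w` is even, so adding the two values isolates `w`.
  have hw : w = 0 := by
    have h1 := h0 J.eC
    have h2 := h0 (-J.eC)
    rw [P_neg, map_neg, P_eC_left] at h2
    rw [P_eC_left] at h1
    rw [hz] at h1 h2
    linear_combination (norm := module) (-(1 / 2) : ℂ) • (h1 + h2)
  have hT : T = 0 := by
    ext1
    ext v
    simpa [hz, hw] using h0 ((1 : ℂ) ⊗ₜ[ℝ] v)
  rw [hz, hw, hT]
  rfl

/-! ### The span of the three fields -/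

theorem mem_spanXYZ_iff {Y : ℂ ⊗[ℝ] V → ℂ ⊗[ℝ] V} :
    Y ∈ J.spanXYZ ↔ ∃ α β γ : ℂ, Y = J.X (α • J.eC, β • 1, γ • J.eC) := by
  have key : ∀ a b c : ℂ, a • J.xField + b • J.yField + c • J.zField =
      J.X (((a - b) / 2 - c) • J.eC, (a + b) • 1, ((b - a) / 2 - c) • J.eC) := by
    intro a b c
    rw [xField, yField, zField, LC_eC]
    simp only [← map_smul, ← map_add]
    congr 1
    simp only [Prod.smul_mk, Prod.mk_add_mk, Prod.mk.injEq]
    refine ⟨by module, by module, by module⟩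
  rw [spanXYZ, Submodule.mem_span_triple]
  constructor
  · rintro ⟨a, b, c, rfl⟩
    exact ⟨_, _, _, key a b c⟩
  · rintro ⟨α, β, γ, rfl⟩
    refine ⟨(β + α - γ) / 2, (β - α + γ) / 2, -(α + γ) / 2, ?_⟩
    rw [key]
    congr <;> ring

/-! ### Fixed vectors -/

variable [FiniteDimensional ℝ V]

/-- The condition that `R - L(Re)` be a derivation is real-linear in `R`, so it passes to the real
and imaginary parts of complex combinations; closure of `lieH` under addition is not needed. -/
theorem exists_extC_of_mem_lieHC {T : Module.End ℂ (ℂ ⊗[ℝ] V)} (hT : T ∈ J.lieHC) :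
    ∃ T₁ T₂ : V →L[ℝ] V, J.IsDer (T₁ - J.Lc (T₁ J.e)) ∧ J.IsDer (T₂ - J.Lc (T₂ J.e)) ∧
      T = extC T₁ + Complex.I • extC T₂ := by
  have hadd : ∀ S T : V →L[ℝ] V, J.IsDer (S - J.Lc (S J.e)) → J.IsDer (T - J.Lc (T J.e)) →
      J.IsDer ((S + T) - J.Lc ((S + T) J.e)) := by
    intro S T hS hT a b
    have h1 := hS a b
    have h2 := hT a b
    simp only [sub_apply, add_apply, map_add, map_sub, LinearMap.add_apply, LinearMap.sub_apply,
      Lc_apply] at h1 h2 ⊢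
    linear_combination (norm := module) h1 + h2
  have hsmul : ∀ (c : ℝ) (T : V →L[ℝ] V), J.IsDer (T - J.Lc (T J.e)) →
      J.IsDer ((c • T) - J.Lc ((c • T) J.e)) := by
    intro c T hT a b
    have h2 := hT a b
    simp only [sub_apply, smul_apply, map_smul, map_sub, LinearMap.smul_apply, LinearMap.sub_apply,
      Lc_apply] at h2 ⊢
    linear_combination (norm := module) c • h2
  have hzero : J.IsDer ((0 : V →L[ℝ] V) - J.Lc ((0 : V →L[ℝ] V) J.e)) := fun a b => by simp
  induction hT using Submodule.span_induction with
  | mem T hT =>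
    obtain ⟨S, hS, rfl⟩ := hT
    exact ⟨S, 0, J.isDer_sub_of_mem_lieH hS, hzero, by ext v; simp⟩
  | zero => exact ⟨0, 0, hzero, hzero, by ext v; simp⟩
  | add S T _ _ hS hT =>
    obtain ⟨S₁, S₂, h1, h2, rfl⟩ := hS
    obtain ⟨T₁, T₂, h3, h4, rfl⟩ := hT
    refine ⟨S₁ + T₁, S₂ + T₂, hadd _ _ h1 h3, hadd _ _ h2 h4, ?_⟩
    rw [extC_add, extC_add]
    module
  | smul c T _ hT =>
    obtain ⟨T₁, T₂, h3, h4, rfl⟩ := hT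
    refine ⟨c.re • T₁ + (-c.im) • T₂, c.im • T₁ + c.re • T₂,
      hadd _ _ (hsmul _ _ h3) (hsmul _ _ h4), hadd _ _ (hsmul _ _ h3) (hsmul _ _ h4), ?_⟩
    simp only [extC_add, extC_smul]
    conv_lhs => rw [← Complex.re_add_im c]
    have hI : (Complex.I * Complex.I) • extC T₂ = -extC T₂ := by
      rw [Complex.I_mul_I]
      module
    rw [Complex.ofReal_neg]
    linear_combination (norm := module) (c.im : ℂ) • hI

theorem IsSimple.eq_smul_e_of_fixed (hJ : J.IsSimple) {S : Subgroup (V →L[ℝ] V)ˣ}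
    (hS : J.isotropy ≤ S) {v : V} (hv : ∀ k ∈ S, (k : V →L[ℝ] V) v = v) :
    ∃ c : ℝ, v = c • J.e :=
  hJ.eq_smul_e_of_innerDer fun a b => apply_eq_zero_of_exp_apply fun t =>
    hv _ (hS ((J.isDer_innerDer a b).expUnit_mem_isotropy t))

theorem IsSimple.eq_smul_eC_of_fixed (hJ : J.IsSimple) {S : Subgroup (V →L[ℝ] V)ˣ}
    (hS : J.isotropy ≤ S) {z : ℂ ⊗[ℝ] V} (hz : ∀ k ∈ S, extC (k : V →L[ℝ] V) z = z) :
    ∃ c : ℂ, z = c • J.eC := by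
  obtain ⟨a, ha⟩ := hJ.eq_smul_e_of_fixed hS (v := rePart z) fun k hk => by
    rw [← rePart_extC, hz k hk]
  obtain ⟨b, hb⟩ := hJ.eq_smul_e_of_fixed hS (v := imPart z) fun k hk => by
    rw [← imPart_extC, hz k hk]
  refine ⟨a + b * Complex.I, ?_⟩
  rw [← tmul_rePart_add z, ha, hb, eC, TensorProduct.smul_tmul', ← TensorProduct.smul_tmul,
    ← TensorProduct.smul_tmul, ← TensorProduct.add_tmul]
  simp

omit [FiniteDimensional ℝ V] in
theorem isotropy_le_fullIsotropy : J.isotropy ≤ J.fullIsotropy := by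
  refine inf_le_inf_right _ ?_
  rintro _ ⟨g, -, rfl⟩
  exact g.2

/-- Common to both groups: only the vanishing of commuting derivations, `hD`, is proved differently
for each. -/
theorem fixedVectors_eq_spanXYZ (hJ : J.IsSimple) {S : Subgroup (V →L[ℝ] V)ˣ}
    (hS : J.isotropy ≤ S) (hS' : S ≤ J.fullIsotropy)
    (hD : ∀ D : V →L[ℝ] V, J.IsDer D →
      (∀ k ∈ S, ∀ v, (k : V →L[ℝ] V) (D v) = D ((k : V →L[ℝ] V) v)) → D = 0) :
    J.fixedVectors S = J.spanXYZ := by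
  have hAut := fun k (hk : k ∈ S) => J.isAut_of_mem_fullIsotropy (hS' hk)
  have hke : ∀ k ∈ S, (k : V →L[ℝ] V) J.e = J.e := fun k hk => (hAut k hk).map_e
  apply le_antisymm
  · rintro _ ⟨⟨⟨z, T, w⟩, ⟨-, hT, -⟩, rfl⟩, hfix⟩
    have hparts := fun k (hk : k ∈ S) =>
      X_injective (((hAut k hk).Ad_X z T w).symm.trans (hfix k hk))
    simp only [Prod.mk.injEq] at hparts
    obtain ⟨α, rfl⟩ := hJ.eq_smul_eC_of_fixed hS fun k hk => (hparts k hk).1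
    obtain ⟨γ, rfl⟩ := hJ.eq_smul_eC_of_fixed hS fun k hk => (hparts k hk).2.2
    have hreal : ∀ R : V →L[ℝ] V, J.IsDer (R - J.Lc (R J.e)) →
        (∀ k ∈ S, ∀ v, (k : V →L[ℝ] V) (R v) = R ((k : V →L[ℝ] V) v)) → ∃ c : ℝ, R = c • 1 := by
      intro R hR hcomm
      obtain ⟨c, hc⟩ := hJ.eq_smul_e_of_fixed hS (v := R J.e) fun k hk => by
        rw [hcomm k hk, hke k hk]
      have h1 : J.Lc (R J.e) = c • 1 := by
        ext v
        simp [hc, J.L_e]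
      rw [h1] at hR
      exact ⟨c, sub_eq_zero.1 (hD _ hR fun k hk v => by simp [hcomm k hk])⟩
    obtain ⟨T₁, T₂, h1, h2, rfl⟩ := exists_extC_of_mem_lieHC hT
    have hcomm : ∀ k ∈ S, ∀ v, (k : V →L[ℝ] V) (T₁ v) = T₁ ((k : V →L[ℝ] V) v) ∧
        (k : V →L[ℝ] V) (T₂ v) = T₂ ((k : V →L[ℝ] V) v) := by
      intro k hk v
      -- Evaluating `kTk⁻¹ = T` at `kv` cancels the inverse.
      have h := LinearMap.congr_fun (hparts k hk).2.1 (extC (k : V →L[ℝ] V) ((1 : ℂ) ⊗ₜ[ℝ] v))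
      rw [Module.End.mul_apply, extC_inv_apply] at h
      simp only [Module.End.mul_apply, LinearMap.add_apply, LinearMap.smul_apply, extC_tmul,
        map_add, TensorProduct.smul_tmul', smul_eq_mul, mul_one] at h
      have hre := congrArg rePart h
      have him := congrArg imPart h
      simp only [map_add, rePart_tmul, imPart_tmul] at hre him
      simpa using And.intro hre him
    obtain ⟨c₁, rfl⟩ := hreal T₁ h1 fun k hk v => (hcomm k hk v).1
    obtain ⟨c₂, rfl⟩ := hreal T₂ h2 fun k hk v => (hcomm k hk v).2
    refine mem_spanXYZ_iff.2 ⟨α, c₁ + Complex.I * c₂, γ, ?_⟩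
    rw [extC_smul, extC_smul, extC_one, add_smul, mul_smul]
  · intro Y hY
    obtain ⟨α, β, γ, rfl⟩ := mem_spanXYZ_iff.1 hY
    refine ⟨⟨_, ⟨trivial, ?_, trivial⟩, rfl⟩, fun k hk => ?_⟩
    · refine Submodule.smul_mem _ _ (Submodule.subset_span ⟨1, J.one_mem_lieH, extC_one⟩)
    · have hkeC : extC (k : V →L[ℝ] V) J.eC = J.eC := by rw [eC, extC_tmul, hke k hk]
      rw [(hAut k hk).Ad_X, map_smul, map_smul, hkeC]
      congr 3
      ext v
      simp [unit_apply_inv]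

/-! ### The bracket -/

theorem hasFDerivAt_X (α β γ : ℂ) (ζ : ℂ ⊗[ℝ] V) :
    HasFDerivAt (J.X (α • J.eC, β • 1, γ • J.eC))
      (LinearMap.toContinuousLinearMap
        ((β • 1 - (2 * γ) • J.LC ζ : Module.End ℂ (ℂ ⊗[ℝ] V)).restrictScalars ℝ)) ζ := by
  let B : ℂ ⊗[ℝ] V →L[ℝ] ℂ ⊗[ℝ] V →L[ℝ] ℂ ⊗[ℝ] V :=
    LinearMap.toContinuousLinearMap (LinearMap.toContinuousLinearMap.toLinearMap ∘ₗ
      LinearMap.mk₂ ℝ (fun a b => J.LC a b) (by simp) (by simp) (by simp) (by simp))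
  let A : ℂ ⊗[ℝ] V →L[ℝ] ℂ ⊗[ℝ] V := LinearMap.toContinuousLinearMap
    ((β • 1 : Module.End ℂ (ℂ ⊗[ℝ] V)).restrictScalars ℝ)
  let G : ℂ ⊗[ℝ] V →L[ℝ] ℂ ⊗[ℝ] V := LinearMap.toContinuousLinearMap
    ((γ • 1 : Module.End ℂ (ℂ ⊗[ℝ] V)).restrictScalars ℝ)
  have h1 : HasFDerivAt (fun ζ : ℂ ⊗[ℝ] V => B ζ ζ) (B ζ + B.flip ζ) ζ := by
    refine (B.hasFDerivAt.clm_apply (hasFDerivAt_id ζ)).congr_fderiv ?_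
    ext h
    simp
  have h2 := ((A.hasFDerivAt (x := ζ)).const_add (α • J.eC)).sub (G.hasFDerivAt.comp ζ h1)
  have hf : J.X (α • J.eC, β • 1, γ • J.eC) = (fun x => α • J.eC + A x) - ⇑G ∘ fun ζ => B ζ ζ := by
    funext ζ
    rw [X_apply, map_smul, P_eC_right]
    rfl
  rw [hf]
  refine h2.congr_fderiv (ContinuousLinearMap.ext fun h => ?_)
  change β • h - γ • (J.LC ζ h + J.LC h ζ) = β • h - (2 * γ) • J.LC ζ h
  rw [J.LC_comm h ζ]
  module

/-- Because `P(ζ)e = ζ²`, this is the computation for quadratic fields on a line; the cubic terms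
`2γγ'ζ·ζ²` cancel. -/
theorem bracket_X (α β γ α' β' γ' : ℂ) :
    bracket (J.X (α • J.eC, β • 1, γ • J.eC)) (J.X (α' • J.eC, β' • 1, γ' • J.eC)) =
      J.X ((β * α' - β' * α) • J.eC, (2 * (α * γ' - γ * α')) • 1, (β' * γ - β * γ') • J.eC) := by
  funext ζ
  rw [bracket, VectorField.lieBracket, (hasFDerivAt_X α β γ ζ).fderiv,
    (hasFDerivAt_X α' β' γ' ζ).fderiv]
  simp only [LinearMap.coe_toContinuousLinearMap', LinearMap.restrictScalars_apply, X_apply,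
    LinearMap.sub_apply, LinearMap.smul_apply, Module.End.one_apply, map_add, map_sub, map_smul,
    P_eC_right, LC_eC_right]
  module

/-! ### The isomorphism with `sl(2, ℂ)`. -/

/-- The vector field attached to a traceless matrix. -/
noncomputable def slField (J : EuclideanJordanAlgebra V) :
    LieAlgebra.SpecialLinear.sl (Fin 2) ℂ →ₗ[ℂ] ℂ ⊗[ℝ] V → ℂ ⊗[ℝ] V where
  -- The infinitesimal fractional linear action: the matrix with rows `(a, b)` and `(c, -a)` gives
  -- `b + 2aζ - cζ²`.
  toFun A := J.X (A.1 0 1 • J.eC, (2 * A.1 0 0) • 1, A.1 1 0 • J.eC)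
  map_add' A B := by
    rw [← map_add]
    simp [add_smul, mul_add]
  map_smul' c A := by
    rw [← map_smul]
    simp [smul_smul, mul_left_comm]

omit [FiniteDimensional ℝ V] in
theorem slField_apply (A : LieAlgebra.SpecialLinear.sl (Fin 2) ℂ) :
    J.slField A = J.X (A.1 0 1 • J.eC, (2 * A.1 0 0) • 1, A.1 1 0 • J.eC) := rfl

theorem sl_apply_one_one (A : LieAlgebra.SpecialLinear.sl (Fin 2) ℂ) : A.1 1 1 = -A.1 0 0 := by
  have h : Matrix.trace A.1 = 0 := A.2
  rw [Matrix.trace_fin_two] at h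
  linear_combination h

theorem slField_lie (A B : LieAlgebra.SpecialLinear.sl (Fin 2) ℂ) :
    J.slField ⁅A, B⁆ = bracket (J.slField A) (J.slField B) := by
  have h : (⁅A, B⁆ : LieAlgebra.SpecialLinear.sl (Fin 2) ℂ).1 = A.1 * B.1 - B.1 * A.1 := rfl
  simp only [slField_apply, bracket_X, h, Matrix.sub_apply, Matrix.mul_apply, Fin.sum_univ_two,
    sl_apply_one_one]
  exact congrArg J.X (Prod.ext (congrArg (· • J.eC) (by ring))
    (Prod.ext (congrArg (· • 1) (by ring)) (congrArg (· • J.eC) (by ring))))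

omit [FiniteDimensional ℝ V] in
theorem IsSimple.slField_injective (hJ : J.IsSimple) : Function.Injective J.slField := by
  rw [← LinearMap.ker_eq_bot, LinearMap.ker_eq_bot']
  intro A hA
  have he : J.eC ≠ 0 := fun h => hJ.e_ne_zero (by simpa [eC] using congrArg rePart h)
  have h1 := X_injective (hA.trans (map_zero J.X).symm)
  simp only [Prod.mk_eq_zero, smul_eq_zero, he, or_false] at h1
  obtain ⟨h01, h00, h10⟩ := h1
  have h00' : A.1 0 0 = 0 := by
    rcases h00 with h | h
    · simpa using h
    · exact absurd (by simpa using LinearMap.congr_fun h J.eC) he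
  ext i j
  fin_cases i <;> fin_cases j <;> simp [h01, h00', h10, sl_apply_one_one]

omit [FiniteDimensional ℝ V] in
theorem range_slField : LinearMap.range J.slField = J.spanXYZ := by
  ext Y
  rw [LinearMap.mem_range, mem_spanXYZ_iff]
  constructor
  · rintro ⟨A, rfl⟩
    exact ⟨_, _, _, rfl⟩
  · rintro ⟨α, β, γ, rfl⟩
    refine ⟨⟨!![β / 2, α; γ, -(β / 2)], ?_⟩, ?_⟩
    · change Matrix.trace (!![β / 2, α; γ, -(β / 2)] : Matrix (Fin 2) (Fin 2) ℂ) = 0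
      simp [Matrix.trace_fin_two]
    · rw [slField_apply]
      simp [mul_div_cancel₀]

end EuclideanJordanAlgebra

theorem mainTheorem4 {V : Type*} [NormedAddCommGroup V] [InnerProductSpace ℝ V]
    [FiniteDimensional ℝ V] (J : EuclideanJordanAlgebra V) (hJ : J.IsSimple) :
    (Module.finrank ℝ V ≠ 3 → J.fixedVectors J.isotropy = J.spanXYZ) ∧
    J.fixedVectors J.fullIsotropy = J.spanXYZ ∧
    ∃ φ : LieAlgebra.SpecialLinear.sl (Fin 2) ℂ ≃ₗ[ℂ] J.spanXYZ,
      ∀ A B : LieAlgebra.SpecialLinear.sl (Fin 2) ℂ,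
        (φ ⁅A, B⁆ : ℂ ⊗[ℝ] V → ℂ ⊗[ℝ] V) = EuclideanJordanAlgebra.bracket (φ A : ℂ ⊗[ℝ] V → ℂ ⊗[ℝ] V) (φ B) := by
  refine ⟨fun hdim => ?_, ?_, ?_⟩
  · refine EuclideanJordanAlgebra.fixedVectors_eq_spanXYZ hJ le_rfl
      EuclideanJordanAlgebra.isotropy_le_fullIsotropy fun D hD hcomm => ?_
    -- Commutation with the isotropy group is differentiated along `exp(t[L(a), L(b)])`.
    exact hJ.derivation_eq_zero_of_commute hdim hD fun a b =>
      EuclideanJordanAlgebra.commute_of_exp_commute fun t =>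
        hcomm _ ((J.isDer_innerDer a b).expUnit_mem_isotropy t)
  · refine EuclideanJordanAlgebra.fixedVectors_eq_spanXYZ hJ
      EuclideanJordanAlgebra.isotropy_le_fullIsotropy le_rfl fun D hD hcomm => ?_
    exact hJ.derivation_eq_zero_of_commute_isAut hD
      (fun a b => EuclideanJordanAlgebra.commute_of_exp_commute fun t =>
        hcomm _ (EuclideanJordanAlgebra.isotropy_le_fullIsotropy
          ((J.isDer_innerDer a b).expUnit_mem_isotropy t)))
      fun g hg => hcomm g hg.mem_fullIsotropy
  · exact ⟨(LinearEquiv.ofInjective J.slField hJ.slField_injective).trans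
      (LinearEquiv.ofEq _ _ EuclideanJordanAlgebra.range_slField),
      EuclideanJordanAlgebra.slField_lie⟩
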